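/- There are absolute constants $C>0$ and $k\in\mathbb N$ such that the following holds. Call $f:\{0,1\}^n\to\mathbb R$ $a$-self-bounding if, writing $\min_{x_i}f(x)$ for the minimum of $f$ over the two values of the $i$-th coordinate (the other coordinates of $x$ being kept), $f(x)-\min_{x_i}f(x)\le 1$ for all $x$ and $i$, and $\sum_{i=1}^n\bigl(f(x)-\min_{x_i}f(x)\bigr)\le a\,f(x)$ for all $x$. Let $n\ge 0$ be an integer, $a\ge 0$ real, $f:\{0,1\}^n\to[0,1]$ an $a$-self-bounding function, and $\varepsilon>0$. Put $L=\max\{\log(1/\varepsilon),0\}$. Then there are an integer $d$ with $0\le d\le C\,\frac{a}{\varepsilon}\,L$ (that is, $d=O(\frac a\varepsilon\log\frac1\varepsilon)$) and a real polynomial $p$ in $n$ variables of degree at most $d$ such that $$\|f-p\|_1\le\varepsilon\qquad\text{and}\qquad \|\hat p\|_1\le 2^{C d^2},$$ where $\|g\|_1=\mathbf E_x|g(x)|$ for $x$ uniform in $\{0,1\}^n$, and $\|\hat p\|_1=\sum_{S\subseteq[n]}|\hat p(S)|$ with $\hat p(S)=\mathbf E_x\bigl[p(x)(-1)^{\sum_{i\in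 S}x_i}\bigr]$. If in addition $f$ is submodular, i.e. $f(x\vee y)+f(x\wedge y)\le f(x)+f(y)$ for all $x,y\in\{0,1\}^n$, then the same $p$ also satisfies $$\|\hat p\|_1\le 2^{\frac{C}{\varepsilon}L^k}$$ (that is, $\|\hat p\|_1=2^{\tilde O(1/\varepsilon)}$). -/

import Mathlib

open scoped BigOperators

noncomputable section

namespace BoolCube

/-- The Boolean hypercube `{0,1}^n`; a point is also read as the subset `{i | x i = true}`. -/
abbrev Cube (n : ℕ) : Type := Fin n → Bool

/-- Expectation with respect to the uniform distribution on `{0,1}^n`. -/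
def expect {n : ℕ} (f : Cube n → ℝ) : ℝ := (∑ x : Cube n, f x) / 2 ^ n

/-- The `ℓ₁` norm with respect to the uniform distribution on `{0,1}^n`. -/
def l1Norm {n : ℕ} (f : Cube n → ℝ) : ℝ := expect fun x => |f x|

/-- The minimum of `f` over the value of the `i`-th coordinate, the others being those of `x`. -/
def minCoord {n : ℕ} (f : Cube n → ℝ) (i : Fin n) (x : Cube n) : ℝ :=
  min (f (Function.update x i false)) (f (Function.update x i true))

/-- `a`-self-bounding functions on `{0,1}^n`. -/
def IsSelfBounding {n : ℕ} (a : ℝ) (f : Cube n → ℝ) : Prop :=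
  (∀ x i, f x - minCoord f i x ≤ 1) ∧
    ∀ x, ∑ i, (f x - minCoord f i x) ≤ a * f x

/-- Submodularity: on subsets of `Fin n`, `⊔` is the union and `⊓` the intersection. -/
def IsSubmodular {n : ℕ} (f : Cube n → ℝ) : Prop :=
  ∀ x y, f (x ⊔ y) + f (x ⊓ y) ≤ f x + f y

/-- The parity function `χ_S(x) = (-1)^(∑_{i ∈ S} x_i)`. -/
def parity {n : ℕ} (S : Finset (Fin n)) (x : Cube n) : ℝ := (-1) ^ (∑ i ∈ S, (x i).toNat)

/-- The Fourier coefficient `f̂(S) = E_x[f(x) χ_S(x)]`. -/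
def fourierCoeff {n : ℕ} (f : Cube n → ℝ) (S : Finset (Fin n)) : ℝ :=
  expect fun x => f x * parity S x

/-- The spectral norm `∑_S |f̂(S)|`, over all subsets `S` of the index set. -/
def fourierL1Norm {n : ℕ} (f : Cube n → ℝ) : ℝ := ∑ S : Finset (Fin n), |fourierCoeff f S|

/-- The function on `{0,1}^n` computed by a real polynomial in `n` variables. -/
def polyFun {n : ℕ} (p : MvPolynomial (Fin n) ℝ) (x : Cube n) : ℝ :=
  MvPolynomial.eval (fun i => ((x i).toNat : ℝ)) p

end BoolCube

end

/-!
Let `T` be the noise operator that flips every bit with probability `(1 - ρ) / 2`. The approximating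
polynomial is `T f`, truncated to the Fourier coefficients of degree at most `d` that lie inside a
small set `J` of coordinates.

*Noise stability.* For an `a`-self-bounding `f` with values in `[0, 1]` the `ℓ₁` influences
`E |f(x) - f(x ⊕ eᵢ)|` add up to at most `2 a`. Applying the noise one coordinate at a time, each
step being a contraction in `ℓ₁`, gives `‖f - T f‖₁ ≤ (1 - ρ) a`
(`IsSelfBounding.l1Norm_sub_noise_le`).
With `1 - ρ = ε / (2 a)` the coefficients of `T f` of degree above `d = O((a / ε) log (1 / ε))` are
negligible in `ℓ₂`. It remains to find `J` with little weight on the sets of size at most `d`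
not contained in `J` (`exists_poly_of_weight_le`); the spectral norm is then at most the number of
subsets of `J` of size at most `d`, that is `(|J| + 1) ^ d`.

*General `f`.* As in Friedgut's theorem, `J` consists of the coordinates with `ℓ₁` influence at least
`2 ^ (-O(d))`. There are `2 ^ O(d)` of them, and the hypercontractive inequality `bonami` shows that
the other coordinates carry little low-degree weight (`weight_outside_le`).

*Submodular `f`.* A submodular function is `2`-self-bounding. Averaging over the coordinates outside
the set above keeps it submodular, and leaves `2 ^ O(d)` coordinates. By the Poincaré inequality a
coordinate whose marginal value exceeds `α` in absolute value only with probability `2⁻ᵏ` contributes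
little weight beyond `α` times its influence, and `k = O(d)` makes the exceptional probabilities
negligible even when summed over all `2 ^ O(d)` coordinates. All but `O(k / α)` coordinates have this
property: marginal values decrease, and a uniformly random set is the union of `k` independent
random sets of density about `1 / k`, so a coordinate whose marginal value at such a sparse set is
large with probability below `1 / 2` has a large one at a uniform set with probability at most `2⁻ᵏ`
(`biased_pow_le`, `IsSubmodular.exists_large_marginal`). Hence `|J|` is polynomial in `1 / ε`.
-/

namespace BoolCube

variable {n : ℕ}

/-! ### Expectations and coordinate flips -/

theorem expect_add (f g : Cube n → ℝ) :
    expect (fun x => f x + g x) = expect f + expect g := by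
  simp only [expect, Finset.sum_add_distrib, add_div]

theorem expect_const_mul (c : ℝ) (f : Cube n → ℝ) :
    expect (fun x => c * f x) = c * expect f := by
  simp only [expect, ← Finset.mul_sum, mul_div_assoc]

theorem expect_const (c : ℝ) : expect (fun _ : Cube n => c) = c := by
  simp [expect]

theorem expect_sum {ι : Type*} (s : Finset ι) (f : ι → Cube n → ℝ) :
    expect (fun x => ∑ i ∈ s, f i x) = ∑ i ∈ s, expect (f i) := by
  simp only [expect]
  rw [Finset.sum_comm, Finset.sum_div]

theorem expect_mono {f g : Cube n → ℝ} (h : ∀ x, f x ≤ g x) : expect f ≤ expect g := by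
  unfold expect
  gcongr
  exact h _

theorem expect_nonneg {f : Cube n → ℝ} (h : ∀ x, 0 ≤ f x) : 0 ≤ expect f := by
  have := expect_mono h
  rwa [expect_const] at this

theorem abs_expect_le (f : Cube n → ℝ) : |expect f| ≤ expect fun x => |f x| := by
  unfold expect
  rw [abs_div, abs_of_pos (by positivity : (0 : ℝ) < 2 ^ n)]
  gcongr
  exact Finset.abs_sum_le_sum_abs _ _

/-- The Cauchy–Schwarz inequality, in the form that takes square roots of `f` and `g`. -/
theorem expect_sq_le_of_sq_le_mul {r f g : Cube n → ℝ} (hf : ∀ x, 0 ≤ f x) (hg : ∀ x, 0 ≤ g x)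
    (h : ∀ x, r x ^ 2 ≤ f x * g x) : expect r ^ 2 ≤ expect f * expect g := by
  have := Finset.sum_sq_le_sum_mul_sum_of_sq_le_mul Finset.univ (r := r) (f := f) (g := g)
    (fun i _ => hf i) (fun i _ => hg i) (fun i _ => h i)
  unfold expect
  rw [div_pow, div_mul_div_comm, sq ((2 : ℝ) ^ n)]
  gcongr

/-- The point `x` with its `i`-th bit negated. -/
def flip (i : Fin n) (x : Cube n) : Cube n := Function.update x i (!x i)

theorem flip_involutive (i : Fin n) : Function.Involutive (flip i) := by
  intro x
  simp [flip]

theorem sum_comp_flip (i : Fin n) (f : Cube n → ℝ) : ∑ x, f (flip i x) = ∑ x, f x :=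
  Equiv.sum_comp (flip_involutive i).toPerm f

theorem expect_comp_flip (i : Fin n) (f : Cube n → ℝ) :
    expect (fun x => f (flip i x)) = expect f := by
  simp only [expect, sum_comp_flip]

theorem expect_eq_zero_of_flip {i : Fin n} {f : Cube n → ℝ} (h : ∀ x, f (flip i x) = -f x) :
    expect f = 0 := by
  have h1 := expect_comp_flip i f
  simp only [h] at h1
  have h2 := expect_const_mul (-1) f
  simp only [neg_one_mul] at h2
  linarith

/-! ### Fourier expansion -/

/-- The function with Fourier coefficients `c`. -/
def synth (c : Finset (Fin n) → ℝ) (x : Cube n) : ℝ := ∑ S, c S * parity S x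

theorem parity_eq_prod (S : Finset (Fin n)) (x : Cube n) :
    parity S x = ∏ i ∈ S, (-1 : ℝ) ^ (x i).toNat := by
  rw [parity, Finset.prod_pow_eq_pow_sum]

theorem parity_mul_self (S : Finset (Fin n)) (x : Cube n) : parity S x * parity S x = 1 := by
  rw [parity, ← pow_add, Even.neg_one_pow ⟨_, rfl⟩]

theorem abs_parity (S : Finset (Fin n)) (x : Cube n) : |parity S x| = 1 := by
  simp [parity]

theorem parity_flip (i : Fin n) (S : Finset (Fin n)) (x : Cube n) :
    parity S (flip i x) = (if i ∈ S then -1 else 1) * parity S x := by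
  have hne : ∀ j, j ≠ i → flip i x j = x j := fun j hj => by simp [flip, hj]
  by_cases h : i ∈ S
  · rw [parity_eq_prod, parity_eq_prod, ← Finset.mul_prod_erase S _ h,
      ← Finset.mul_prod_erase S _ h, if_pos h, ← mul_assoc]
    congr 1
    · cases hx : x i <;> simp [flip, hx]
    · exact Finset.prod_congr rfl fun j hj => by rw [hne j (Finset.ne_of_mem_erase hj)]
  · rw [parity_eq_prod, parity_eq_prod, if_neg h, one_mul]
    exact Finset.prod_congr rfl fun j hj => by rw [hne j (fun e => h (e ▸ hj))]

theorem expect_parity_mul_parity (S T : Finset (Fin n)) :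
    expect (fun x => parity S x * parity T x) = if S = T then 1 else 0 := by
  split_ifs with h
  · subst h
    simp only [parity_mul_self, expect_const]
  · obtain ⟨i, hi⟩ : ∃ i, ¬(i ∈ S ↔ i ∈ T) := by
      by_contra! hc
      exact h (Finset.ext hc)
    refine expect_eq_zero_of_flip (i := i) fun x => ?_
    rw [parity_flip, parity_flip]
    by_cases h1 : i ∈ S <;> by_cases h2 : i ∈ T <;> simp_all

theorem sum_parity_mul_parity (x y : Cube n) :
    ∑ S, parity S x * parity S y = if x = y then 2 ^ n else 0 := by
  have h1 : ∑ S, parity S x * parity S y =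
      ∏ i : Fin n, (1 + (-1 : ℝ) ^ (x i).toNat * (-1 : ℝ) ^ (y i).toNat) := by
    rw [Finset.prod_one_add, Finset.powerset_univ]
    exact Finset.sum_congr rfl fun S _ => by
      rw [parity_eq_prod, parity_eq_prod, Finset.prod_mul_distrib]
  rw [h1]
  split_ifs with h
  · subst h
    have : ∀ i, (1 + (-1 : ℝ) ^ (x i).toNat * (-1 : ℝ) ^ (x i).toNat) = 2 := fun i => by
      cases x i <;> norm_num
    simp [this]
  · obtain ⟨i, hi⟩ := Function.ne_iff.mp h
    refine Finset.prod_eq_zero (Finset.mem_univ i) ?_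
    cases hx : x i <;> cases hy : y i <;> simp_all

theorem synth_fourierCoeff (f : Cube n → ℝ) : synth (fourierCoeff f) = f := by
  funext x
  have h1 : synth (fourierCoeff f) x =
      (∑ y, f y * ∑ S, parity S x * parity S y) / 2 ^ n := by
    simp only [synth, fourierCoeff, expect, div_mul_eq_mul_div, Finset.sum_mul, Finset.mul_sum]
    rw [← Finset.sum_div, Finset.sum_comm]
    congr 1
    exact Finset.sum_congr rfl fun y _ => Finset.sum_congr rfl fun S _ => by ring
  rw [h1]
  simp [sum_parity_mul_parity]

theorem fourierCoeff_synth (c : Finset (Fin n) → ℝ) : fourierCoeff (synth c) = c := by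
  funext T
  have h1 : fourierCoeff (synth c) T =
      ∑ S, c S * expect (fun x => parity S x * parity T x) := by
    simp only [← expect_const_mul, ← expect_sum]
    simp only [fourierCoeff, synth, Finset.sum_mul, mul_assoc]
  rw [h1]
  simp [expect_parity_mul_parity]

theorem expect_synth_mul (c : Finset (Fin n) → ℝ) (f : Cube n → ℝ) :
    expect (fun x => f x * synth c x) = ∑ S, c S * fourierCoeff f S := by
  simp only [fourierCoeff, ← expect_const_mul, ← expect_sum]
  simp only [synth, Finset.mul_sum, mul_left_comm]

theorem expect_synth_sq (c : Finset (Fin n) → ℝ) :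
    expect (fun x => synth c x ^ 2) = ∑ S, c S ^ 2 := by
  simp only [sq, expect_synth_mul, fourierCoeff_synth]

theorem sum_fourierCoeff_sq (f : Cube n → ℝ) :
    ∑ S, fourierCoeff f S ^ 2 = expect fun x => f x ^ 2 := by
  rw [← expect_synth_sq, synth_fourierCoeff]

theorem synth_add (c c' : Finset (Fin n) → ℝ) (x : Cube n) :
    synth (fun S => c S + c' S) x = synth c x + synth c' x := by
  simp only [synth, add_mul, Finset.sum_add_distrib]

theorem synth_sub (c c' : Finset (Fin n) → ℝ) (x : Cube n) :
    synth (fun S => c S - c' S) x = synth c x - synth c' x := by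
  simp only [synth, sub_mul, Finset.sum_sub_distrib]

theorem synth_const_mul (r : ℝ) (c : Finset (Fin n) → ℝ) (x : Cube n) :
    synth (fun S => r * c S) x = r * synth c x := by
  simp only [synth, mul_assoc, Finset.mul_sum]

theorem synth_flip (i : Fin n) (c : Finset (Fin n) → ℝ) (x : Cube n) :
    synth c (flip i x) = synth (fun S => (if i ∈ S then -1 else 1) * c S) x := by
  simp only [synth, parity_flip]
  exact Finset.sum_congr rfl fun S _ => by ring

theorem l1Norm_sq_le (f : Cube n → ℝ) : l1Norm f ^ 2 ≤ expect fun x => f x ^ 2 := by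
  have := expect_sq_le_of_sq_le_mul (r := fun x => |f x|) (f := fun _ => 1)
    (g := fun x => f x ^ 2) (fun _ => zero_le_one) (fun x => sq_nonneg _) (fun x => by simp)
  rwa [expect_const, one_mul] at this

theorem l1Norm_add_le (f g : Cube n → ℝ) :
    l1Norm (fun x => f x + g x) ≤ l1Norm f + l1Norm g := by
  simp only [l1Norm, ← expect_add]
  exact expect_mono fun x => abs_add_le _ _

/-! ### Noise operators -/

/-- The noise operator with parameter `ρ` acting on the coordinates in `A` only:
each of them is flipped independently with probability `(1 - ρ) / 2`. It is encoded by its action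
on Fourier coefficients. For `ρ = 0` it averages `f` over the coordinates in `A`. -/
noncomputable def noise (ρ : ℝ) (A : Finset (Fin n)) (f : Cube n → ℝ) : Cube n → ℝ :=
  synth fun S => ρ ^ (S ∩ A).card * fourierCoeff f S

theorem fourierCoeff_noise (ρ : ℝ) (A : Finset (Fin n)) (f : Cube n → ℝ) (S : Finset (Fin n)) :
    fourierCoeff (noise ρ A f) S = ρ ^ (S ∩ A).card * fourierCoeff f S := by
  rw [noise, fourierCoeff_synth]

theorem noise_empty (ρ : ℝ) (f : Cube n → ℝ) : noise ρ ∅ f = f := by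
  simp [noise, synth_fourierCoeff]

theorem card_inter_insert {i : Fin n} {A : Finset (Fin n)} (hi : i ∉ A) (S : Finset (Fin n)) :
    (S ∩ insert i A).card = (S ∩ A).card + if i ∈ S then 1 else 0 := by
  split_ifs with h
  · rw [Finset.inter_insert_of_mem h, Finset.card_insert_of_notMem (by simp [hi])]
  · rw [Finset.inter_insert_of_notMem h, add_zero]

theorem noise_insert (ρ : ℝ) {i : Fin n} {A : Finset (Fin n)} (hi : i ∉ A) (f : Cube n → ℝ)
    (x : Cube n) : noise ρ (insert i A) f x =
      (1 + ρ) / 2 * noise ρ A f x + (1 - ρ) / 2 * noise ρ A f (flip i x) := by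
  simp only [noise, synth_flip, ← synth_const_mul, ← synth_add, card_inter_insert hi]
  congr 1
  funext S
  split_ifs <;> ring

/-- Moving from `f` to its noisy version costs, in `ℓ₁`, at most the flip probability times the
total `ℓ₁` influence: the coordinates are treated one at a time, and each single-coordinate noise
operator is a contraction in `ℓ₁`. -/
theorem l1Norm_sub_noise_le {ρ : ℝ} (h0 : 0 ≤ ρ) (h1 : ρ ≤ 1) (A : Finset (Fin n))
    (f : Cube n → ℝ) : l1Norm (fun x => f x - noise ρ A f x) ≤
      (1 - ρ) / 2 * ∑ i ∈ A, expect fun x => |f x - f (flip i x)| := by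
  induction A using Finset.induction_on with
  | empty => simp [noise_empty, l1Norm, expect_const]
  | insert i A hi ih =>
    rw [Finset.sum_insert hi, mul_add]
    set u : Cube n → ℝ := fun x => f x - noise ρ A f x with hu
    have hx : ∀ x, |f x - noise ρ (insert i A) f x| ≤
        (1 - ρ) / 2 * |f x - f (flip i x)| +
          ((1 + ρ) / 2 * |u x| + (1 - ρ) / 2 * |u (flip i x)|) := by
      intro x
      have e : f x - noise ρ (insert i A) f x = (1 - ρ) / 2 * (f x - f (flip i x)) +
          ((1 + ρ) / 2 * u x + (1 - ρ) / 2 * u (flip i x)) := by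
        rw [noise_insert ρ hi, hu]
        ring
      have p1 : 0 ≤ (1 - ρ) / 2 := by linarith
      have p2 : 0 ≤ (1 + ρ) / 2 := by linarith
      rw [e]
      refine (abs_add_le _ _).trans (add_le_add ?_ ((abs_add_le _ _).trans (add_le_add ?_ ?_)))
      · rw [abs_mul, abs_of_nonneg p1]
      · rw [abs_mul, abs_of_nonneg p2]
      · rw [abs_mul, abs_of_nonneg p1]
    refine (expect_mono hx).trans ?_
    rw [expect_add, expect_add, expect_const_mul, expect_const_mul, expect_const_mul,
      expect_comp_flip i fun x => |u x|]
    have : expect (fun x => |u x|) = l1Norm u := rfl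
    rw [this]
    linarith

/-! ### Influences -/

/-- The `ℓ₁` influence of the `i`-th coordinate, normalized as `E |(f(x) - f(x ⊕ eᵢ)) / 2|`. -/
noncomputable def influence (f : Cube n → ℝ) (i : Fin n) : ℝ :=
  expect fun x => |(f x - f (flip i x)) / 2|

theorem influence_nonneg (f : Cube n → ℝ) (i : Fin n) : 0 ≤ influence f i :=
  expect_nonneg fun _ => abs_nonneg _

theorem expect_abs_sub_flip (f : Cube n → ℝ) (i : Fin n) :
    expect (fun x => |f x - f (flip i x)|) = 2 * influence f i := by
  rw [influence, ← expect_const_mul]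
  congr 1
  funext x
  rw [abs_div, abs_two]
  ring

theorem minCoord_eq (f : Cube n → ℝ) (i : Fin n) (x : Cube n) :
    minCoord f i x = min (f x) (f (flip i x)) := by
  have hx : Function.update x i (x i) = x := Function.update_eq_self i x
  unfold minCoord flip
  cases h : x i
  · rw [h] at hx
    rw [hx]
    rfl
  · rw [h] at hx
    rw [hx, min_comm]
    rfl

theorem influence_eq (f : Cube n → ℝ) (i : Fin n) :
    influence f i = expect fun x => f x - minCoord f i x := by
  have h1 : expect (fun x => f x - minCoord f i x) =
      expect fun x => (f x - f (flip i x)) / 2 + |(f x - f (flip i x)) / 2| := by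
    congr 1
    funext x
    rw [minCoord_eq]
    rcases le_total (f x) (f (flip i x)) with h | h
    · rw [min_eq_left h, abs_of_nonpos (by linarith)]
      ring
    · rw [min_eq_right h, abs_of_nonneg (by linarith)]
      ring
  rw [h1, expect_add, expect_eq_zero_of_flip (i := i), zero_add, influence]
  intro x
  rw [flip_involutive i x]
  ring

theorem expect_mem_unit {f : Cube n → ℝ} (hf : ∀ x, 0 ≤ f x ∧ f x ≤ 1) :
    0 ≤ expect f ∧ expect f ≤ 1 := by
  refine ⟨expect_nonneg fun x => (hf x).1, ?_⟩
  have := expect_mono fun x => (hf x).2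
  rwa [expect_const] at this

theorem IsSelfBounding.sum_influence_le {a : ℝ} {f : Cube n → ℝ} (h : IsSelfBounding a f)
    (ha : 0 ≤ a) (hf : ∀ x, 0 ≤ f x ∧ f x ≤ 1) : ∑ i, influence f i ≤ a := by
  simp only [influence_eq, ← expect_sum]
  refine (expect_mono h.2).trans ?_
  rw [expect_const_mul]
  exact mul_le_of_le_one_right ha (expect_mem_unit hf).2

theorem IsSelfBounding.l1Norm_sub_noise_le {a : ℝ} {f : Cube n → ℝ} (h : IsSelfBounding a f)
    (ha : 0 ≤ a) (hf : ∀ x, 0 ≤ f x ∧ f x ≤ 1) {ρ : ℝ} (h0 : 0 ≤ ρ) (h1 : ρ ≤ 1) :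
    l1Norm (fun x => f x - noise ρ Finset.univ f x) ≤ (1 - ρ) * a := by
  refine (BoolCube.l1Norm_sub_noise_le h0 h1 Finset.univ f).trans ?_
  simp only [expect_abs_sub_flip, ← Finset.mul_sum]
  have := mul_le_mul_of_nonneg_left (h.sum_influence_le ha hf) (sub_nonneg.mpr h1)
  linarith

theorem half_diff_eq_synth (f : Cube n → ℝ) (i : Fin n) :
    (fun x => (f x - f (flip i x)) / 2) =
      synth fun S => if i ∈ S then fourierCoeff f S else 0 := by
  funext x
  conv_lhs => rw [← synth_fourierCoeff f]
  rw [synth_flip, ← synth_sub, div_eq_inv_mul, ← synth_const_mul]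
  congr 1
  funext S
  split_ifs <;> ring

theorem fourierCoeff_half_diff (f : Cube n → ℝ) (i : Fin n) (S : Finset (Fin n)) :
    fourierCoeff (fun x => (f x - f (flip i x)) / 2) S = if i ∈ S then fourierCoeff f S else 0 := by
  rw [half_diff_eq_synth, fourierCoeff_synth]

/-! ### Hypercontractivity -/

/-- The `(2, 4)` hypercontractive inequality of Bonami for the noise operator on the coordinates
in `A`, by induction on `A`. The functions to which it applies are those whose frequencies all
have the same trace outside `A`: this class contains the even and the odd part of each of its
members with respect to any coordinate, and for `A = ∅` it consists of multiples of parities. -/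
theorem bonami {ρ : ℝ} (hρ : ρ ^ 2 = 1 / 3) (A : Finset (Fin n)) :
    ∀ (B : Finset (Fin n)) (c : Finset (Fin n) → ℝ), (∀ S, c S ≠ 0 → S \ A = B) →
      expect (fun x => synth (fun S => ρ ^ (S ∩ A).card * c S) x ^ 4) ≤ (∑ S, c S ^ 2) ^ 2 := by
  induction A using Finset.induction_on with
  | empty =>
    intro B c hc
    have hc' : ∀ S, S ≠ B → c S = 0 := fun S hS => by
      by_contra h
      exact hS (by simpa using hc S h)
    have h1 : ∀ x, synth (fun S => ρ ^ (S ∩ ∅).card * c S) x = c B * parity B x := by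
      intro x
      simp only [synth, Finset.inter_empty, Finset.card_empty, pow_zero, one_mul]
      exact Finset.sum_eq_single B (fun S _ hS => by rw [hc' S hS, zero_mul]) (by simp)
    have h2 : ∑ S, c S ^ 2 = c B ^ 2 :=
      Finset.sum_eq_single B (fun S _ hS => by rw [hc' S hS]; norm_num) (by simp)
    have h3 : ∀ x, (c B * parity B x) ^ 4 = c B ^ 4 := fun x => by
      have := parity_mul_self B x
      calc (c B * parity B x) ^ 4 = c B ^ 4 * (parity B x * parity B x) ^ 2 := by ring
        _ = c B ^ 4 := by rw [this]; ring
    simp only [h1, h2, h3, expect_const]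
    exact le_of_eq (by ring)
  | insert i A hi ih =>
    intro B c hc
    set c0 : Finset (Fin n) → ℝ := fun S => if i ∈ S then 0 else c S with hc0
    set c1 : Finset (Fin n) → ℝ := fun S => if i ∈ S then c S else 0 with hc1
    set u := synth fun S => ρ ^ (S ∩ A).card * c0 S with hu
    set v := synth fun S => ρ ^ (S ∩ A).card * c1 S with hv
    have hsplit : ∀ x, synth (fun S => ρ ^ (S ∩ insert i A).card * c S) x = u x + ρ * v x := by
      intro x
      rw [hu, hv, ← synth_const_mul, ← synth_add]
      congr 1
      funext S
      simp only [card_inter_insert hi, hc0, hc1]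
      split_ifs <;> ring
    have huf : ∀ x, u (flip i x) = u x := fun x => by
      rw [hu, synth_flip]
      congr 1
      funext S
      simp only [hc0]
      split_ifs <;> ring
    have hvf : ∀ x, v (flip i x) = -v x := fun x => by
      rw [hv, synth_flip, neg_eq_neg_one_mul (synth _ x), ← synth_const_mul]
      congr 1
      funext S
      simp only [hc1]
      split_ifs <;> ring
    have hU := ih (B.erase i) c0 fun S hS => by
      have hiS : i ∉ S := fun h => hS (by simp [hc0, h])
      have hS' := hc S (by simpa [hc0, hiS] using hS)
      rw [← hS', ← Finset.erase_sdiff_comm, Finset.erase_eq_of_notMem hiS,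
        Finset.sdiff_insert_of_notMem hiS]
    have hV := ih (insert i B) c1 fun S hS => by
      have hiS : i ∈ S := by
        by_contra h
        exact hS (by simp [hc1, h])
      have hS' := hc S (by simpa [hc1, hiS] using hS)
      rw [← hS']
      ext j
      by_cases hj : j = i
      · simp [hj, hiS, hi]
      · simp [hj]
    rw [← hu] at hU
    rw [← hv] at hV
    have hsum : ∑ S, c S ^ 2 = ∑ S, c0 S ^ 2 + ∑ S, c1 S ^ 2 := by
      rw [← Finset.sum_add_distrib]
      refine Finset.sum_congr rfl fun S _ => ?_
      simp only [hc0, hc1]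
      split_ifs <;> ring
    set P := ∑ S, c0 S ^ 2
    set Q := ∑ S, c1 S ^ 2
    have hP : 0 ≤ P := Finset.sum_nonneg fun _ _ => sq_nonneg _
    have hQ : 0 ≤ Q := Finset.sum_nonneg fun _ _ => sq_nonneg _
    -- The terms that are odd in `v` change sign under the flip of coordinate `i`.
    have hodd : expect (fun x => 4 * ρ * u x ^ 3 * v x + 4 * ρ ^ 3 * u x * v x ^ 3) = 0 :=
      expect_eq_zero_of_flip (i := i) fun x => by
        rw [huf, hvf]
        ring
    have hmix : expect (fun x => u x ^ 2 * v x ^ 2) ≤ P * Q := by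
      refine abs_le_of_sq_le_sq' ?_ (mul_nonneg hP hQ) |>.2
      refine (expect_sq_le_of_sq_le_mul (f := fun x => u x ^ 4) (g := fun x => v x ^ 4)
        (fun x => by positivity) (fun x => by positivity) fun x => le_of_eq (by ring)).trans ?_
      rw [mul_pow]
      exact mul_le_mul hU hV (expect_nonneg fun x => by positivity) (by positivity)
    have hexp : expect (fun x => (u x + ρ * v x) ^ 4) =
        expect (fun x => u x ^ 4) + 6 * ρ ^ 2 * expect (fun x => u x ^ 2 * v x ^ 2) +
          (ρ ^ 2) ^ 2 * expect (fun x => v x ^ 4) := by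
      rw [← add_zero (expect (fun x => u x ^ 4) + _ + _), ← hodd, ← expect_const_mul,
        ← expect_const_mul, ← expect_add, ← expect_add, ← expect_add]
      congr 1
      funext x
      ring
    simp only [hsplit]
    rw [hexp, hρ, hsum]
    nlinarith [sq_nonneg Q]

/-! ### Low-degree weight outside the influential coordinates -/

/-- The real-number core of the duality argument: it amounts to `N ≤ e ^ (3 / 2) ≤ θ * e`. -/
theorem le_mul_of_sq_le {N e E θ : ℝ} (hN : 0 ≤ N) (he : 0 ≤ e) (hθ : 0 ≤ θ) (heθ : e ≤ θ ^ 2)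
    (h1 : N ^ 2 ≤ e * E) (h2 : E ^ 2 ≤ e * N ^ 2) : N ≤ θ * e := by
  rcases hN.eq_or_lt with h0 | hpos
  · rw [← h0]
    exact mul_nonneg hθ he
  have h4 : N ^ 2 * N ^ 2 ≤ e ^ 3 * N ^ 2 := by
    calc N ^ 2 * N ^ 2 ≤ (e * E) * (e * E) :=
          mul_le_mul h1 h1 (sq_nonneg N) ((sq_nonneg N).trans h1)
      _ = e ^ 2 * E ^ 2 := by ring
      _ ≤ e ^ 2 * (e * N ^ 2) := by gcongr
      _ = e ^ 3 * N ^ 2 := by ring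
  have h5 : N ^ 2 ≤ e ^ 3 := le_of_mul_le_mul_right h4 (by positivity)
  refine abs_le_of_sq_le_sq' ?_ (mul_nonneg hθ he) |>.2
  calc N ^ 2 ≤ e * e ^ 2 := by linarith [h5, (by ring : e ^ 3 = e * e ^ 2)]
    _ ≤ θ ^ 2 * e ^ 2 := by gcongr
    _ = (θ * e) ^ 2 := by ring

/-- Dual form of hypercontractivity: the low-degree Fourier weight of a function `g` with values in
`[-1, 1]` is at most `3 ^ d` times the power `3 / 2` of its `ℓ₁` norm. -/
theorem lowDegree_weight_le {g : Cube n → ℝ} (hg : ∀ x, |g x| ≤ 1) {θ : ℝ} (hθ : 0 ≤ θ)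
    (hgθ : l1Norm g ≤ θ ^ 2) (d : ℕ) :
    ∑ S, (if S.card ≤ d then fourierCoeff g S ^ 2 else 0) ≤ 3 ^ d * (θ * l1Norm g) := by
  set ρ : ℝ := √(1 / 3) with hρ
  have hρ2 : ρ ^ 2 = 1 / 3 := Real.sq_sqrt (by norm_num)
  set c : Finset (Fin n) → ℝ := fun S => ρ ^ S.card * fourierCoeff g S with hc
  set N : ℝ := ∑ S, c S ^ 2 with hN
  set h : Cube n → ℝ := synth fun S => ρ ^ S.card * c S with hh
  set e : ℝ := l1Norm g with he
  have he0 : 0 ≤ e := expect_nonneg fun _ => abs_nonneg _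
  have hN0 : 0 ≤ N := Finset.sum_nonneg fun _ _ => sq_nonneg _
  have hb : expect (fun x => h x ^ 4) ≤ N ^ 2 := by
    have := bonami hρ2 Finset.univ ∅ c (by simp)
    simpa only [Finset.inter_univ] using this
  have hNe : N = expect fun x => g x * h x := by
    rw [expect_synth_mul, hN]
    exact Finset.sum_congr rfl fun S _ => by simp only [hc]; ring
  have h1 : N ^ 2 ≤ e * expect fun x => |g x| * h x ^ 2 := by
    rw [hNe]
    exact expect_sq_le_of_sq_le_mul (f := fun x => |g x|) (g := fun x => |g x| * h x ^ 2)
      (fun x => abs_nonneg _) (fun x => by positivity)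
      fun x => le_of_eq (by rw [← mul_assoc, ← sq, sq_abs]; ring)
  have h2 : (expect fun x => |g x| * h x ^ 2) ^ 2 ≤ e * N ^ 2 := by
    refine (expect_sq_le_of_sq_le_mul (f := fun x => |g x|) (g := fun x => h x ^ 4)
      (fun x => abs_nonneg _) (fun x => by positivity) fun x => ?_).trans
      (mul_le_mul_of_nonneg_left hb he0)
    rw [mul_pow, (by ring : h x ^ 4 = (h x ^ 2) ^ 2)]
    refine mul_le_mul_of_nonneg_right ?_ (sq_nonneg _)
    rw [sq]
    exact mul_le_of_le_one_left (abs_nonneg _) (hg x)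
  have h3 : N ≤ θ * e := le_mul_of_sq_le hN0 he0 hθ hgθ h1 h2
  have h6 : ∑ S, (if S.card ≤ d then fourierCoeff g S ^ 2 else 0) ≤ 3 ^ d * N := by
    rw [hN, Finset.mul_sum]
    refine Finset.sum_le_sum fun S _ => ?_
    split_ifs with hS
    · have : c S ^ 2 = (1 / 3) ^ S.card * fourierCoeff g S ^ 2 := by
        rw [hc, ← hρ2, ← pow_mul, mul_pow, ← pow_mul, mul_comm 2]
      rw [this, ← mul_assoc, one_div, inv_pow]
      refine le_mul_of_one_le_left (sq_nonneg _) ?_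
      rw [← div_eq_mul_inv, one_le_div (by positivity)]
      exact pow_le_pow_right₀ (by norm_num) hS
    · positivity
  exact h6.trans (by gcongr)

/-- Coordinates of small influence carry little low-degree Fourier weight. -/
theorem weight_outside_le {f : Cube n → ℝ} (hf : ∀ x, 0 ≤ f x ∧ f x ≤ 1) {a : ℝ}
    (ha : ∑ i, influence f i ≤ a) {θ : ℝ} (hθ : 0 ≤ θ) (J : Finset (Fin n))
    (hJ : ∀ i ∉ J, influence f i ≤ θ ^ 2) (d : ℕ) :
    ∑ S, (if S.card ≤ d ∧ ¬S ⊆ J then fourierCoeff f S ^ 2 else 0) ≤ 3 ^ d * (θ * a) := by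
  have h1 : ∀ i ∉ J, ∑ S, (if S.card ≤ d then (if i ∈ S then fourierCoeff f S else 0) ^ 2 else 0) ≤
      3 ^ d * (θ * influence f i) := by
    intro i hi
    have := lowDegree_weight_le (g := fun x => (f x - f (flip i x)) / 2) (fun x => ?_) hθ
      (hJ i hi) d
    · simp only [fourierCoeff_half_diff] at this
      exact this
    · have h1 := hf x
      have h2 := hf (flip i x)
      rw [abs_le]
      constructor <;> linarith
  calc ∑ S, (if S.card ≤ d ∧ ¬S ⊆ J then fourierCoeff f S ^ 2 else 0)
      ≤ ∑ S, ∑ i ∈ Jᶜ, (if S.card ≤ d then (if i ∈ S then fourierCoeff f S else 0) ^ 2 else 0) := by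
        refine Finset.sum_le_sum fun S _ => ?_
        have hnn : ∀ j, 0 ≤
            if S.card ≤ d then (if j ∈ S then fourierCoeff f S else 0) ^ 2 else 0 := fun j => by
          split_ifs <;> positivity
        by_cases h : S.card ≤ d ∧ ¬S ⊆ J
        · obtain ⟨i, hiS, hiJ⟩ := Finset.not_subset.mp h.2
          rw [if_pos h]
          refine le_trans ?_ (Finset.single_le_sum (fun j _ => hnn j) (Finset.mem_compl.mpr hiJ))
          simp [h.1, hiS]
        · rw [if_neg h]
          exact Finset.sum_nonneg fun j _ => hnn j
    _ = ∑ i ∈ Jᶜ, ∑ S, (if S.card ≤ d then (if i ∈ S then fourierCoeff f S else 0) ^ 2 else 0) :=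
        Finset.sum_comm
    _ ≤ ∑ i ∈ Jᶜ, 3 ^ d * (θ * influence f i) :=
        Finset.sum_le_sum fun i hi => h1 i (Finset.mem_compl.mp hi)
    _ = 3 ^ d * (θ * ∑ i ∈ Jᶜ, influence f i) := by simp only [Finset.mul_sum]
    _ ≤ 3 ^ d * (θ * a) := by
        gcongr
        exact (Finset.sum_le_univ_sum_of_nonneg fun i => influence_nonneg f i).trans ha

/-! ### Biased product measures -/

/-- The weight of `x` when each bit is independently `false` with probability `r`. -/
def weight (r : ℝ) (x : Cube n) : ℝ := ∏ i, if x i then 1 - r else r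

/-- The probability of `A` when each bit is independently `false` with probability `r`. -/
noncomputable def biased (r : ℝ) (A : Set (Cube n)) : ℝ := ∑ x, A.indicator (weight r) x

theorem weight_nonneg {r : ℝ} (h0 : 0 ≤ r) (h1 : r ≤ 1) (x : Cube n) : 0 ≤ weight r x :=
  Finset.prod_nonneg fun i _ => by split_ifs <;> linarith

theorem sum_weight (r : ℝ) : ∑ x : Cube n, weight r x = 1 := by
  have := (Fintype.prod_sum fun (_ : Fin n) (b : Bool) => if b then 1 - r else r).symm
  simpa [weight] using this

theorem biased_nonneg {r : ℝ} (h0 : 0 ≤ r) (h1 : r ≤ 1) (A : Set (Cube n)) : 0 ≤ biased r A :=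
  Finset.sum_nonneg fun x _ => Set.indicator_nonneg (fun y _ => weight_nonneg h0 h1 y) x

theorem biased_le_one {r : ℝ} (h0 : 0 ≤ r) (h1 : r ≤ 1) (A : Set (Cube n)) : biased r A ≤ 1 := by
  rw [← sum_weight (n := n) r]
  exact Finset.sum_le_sum fun x _ =>
    Set.indicator_le_self' (fun y _ => weight_nonneg h0 h1 y) x

/-- The union of independent biased random sets is a biased random set. -/
theorem sum_weight_mul_weight (r s : ℝ) (z : Cube n) :
    ∑ x, ∑ y, (if x ⊔ y = z then weight r x * weight s y else 0) = weight (r * s) z := by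
  have h1 : ∀ x y : Cube n, (if x ⊔ y = z then weight r x * weight s y else 0) =
      ∏ i, if (x i || y i) = z i then
        (if x i then 1 - r else r) * (if y i then 1 - s else s) else 0 := by
    intro x y
    split_ifs with h
    · rw [weight, weight, ← Finset.prod_mul_distrib]
      refine Finset.prod_congr rfl fun i _ => ?_
      have hi : (x i || y i) = z i := congrFun h i
      rw [if_pos hi]
    · obtain ⟨i, hi⟩ := Function.ne_iff.mp h
      exact (Finset.prod_eq_zero (Finset.mem_univ i) (if_neg hi)).symm
  have h2 : ∀ x : Cube n, ∑ y : Cube n, (if x ⊔ y = z then weight r x * weight s y else 0) =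
      ∏ i, ∑ b : Bool, if (x i || b) = z i then
        (if x i then 1 - r else r) * (if b then 1 - s else s) else 0 := by
    intro x
    simp only [h1]
    exact (Fintype.prod_sum fun (i : Fin n) (b : Bool) => if (x i || b) = z i then
        (if x i then 1 - r else r) * (if b then 1 - s else s) else 0).symm
  simp only [h2]
  rw [← Fintype.prod_sum fun (i : Fin n) (a : Bool) => ∑ b : Bool, if (a || b) = z i then
        (if a then 1 - r else r) * (if b then 1 - s else s) else 0, weight]
  refine Finset.prod_congr rfl fun i _ => ?_
  cases z i
  · simp
  · simp
    ring

theorem biased_mul_le {r s : ℝ} (hr0 : 0 ≤ r) (hr1 : r ≤ 1) (hs0 : 0 ≤ s) (hs1 : s ≤ 1)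
    {A : Set (Cube n)} (hA : IsLowerSet A) : biased (r * s) A ≤ biased r A * biased s A := by
  classical
  have h1 : biased (r * s) A =
      ∑ x, ∑ y, if x ⊔ y ∈ A then weight r x * weight s y else 0 := by
    have : ∀ z, A.indicator (weight (r * s)) z =
        ∑ x, ∑ y, if x ⊔ y = z then (if z ∈ A then weight r x * weight s y else 0) else 0 := by
      intro z
      rw [Set.indicator_apply, ← sum_weight_mul_weight]
      split_ifs <;> simp
    simp only [biased, this]
    rw [Finset.sum_comm]
    refine Finset.sum_congr rfl fun x _ => ?_
    rw [Finset.sum_comm]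
    exact Finset.sum_congr rfl fun y _ => by rw [Finset.sum_ite_eq]; simp
  rw [h1, biased, biased, Finset.sum_mul_sum]
  refine Finset.sum_le_sum fun x _ => Finset.sum_le_sum fun y _ => ?_
  have hx := weight_nonneg hr0 hr1 x
  have hy := weight_nonneg hs0 hs1 y
  split_ifs with h
  · rw [Set.indicator_of_mem (hA le_sup_left h), Set.indicator_of_mem (hA le_sup_right h)]
  · exact mul_nonneg (Set.indicator_nonneg (fun y _ => weight_nonneg hr0 hr1 y) x)
      (Set.indicator_nonneg (fun y _ => weight_nonneg hs0 hs1 y) y)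

/-- A union of `k` independent random sets lies in a down-closed family only if all of them do. -/
theorem biased_pow_le {r : ℝ} (h0 : 0 ≤ r) (h1 : r ≤ 1) {A : Set (Cube n)} (hA : IsLowerSet A)
    (k : ℕ) : biased (r ^ k) A ≤ biased r A ^ k := by
  induction k with
  | zero => simpa using biased_le_one zero_le_one le_rfl A
  | succ k ih =>
    rw [pow_succ, pow_succ]
    exact (biased_mul_le (pow_nonneg h0 k) (pow_le_one₀ h0 h1) h0 h1 hA).trans
      (mul_le_mul_of_nonneg_right ih (biased_nonneg h0 h1 A))

theorem biased_half (A : Set (Cube n)) : biased (1 / 2) A = expect (A.indicator 1) := by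
  have : ∀ x : Cube n, weight (1 / 2) x = 1 / 2 ^ n := fun x => by
    have e : ∀ b : Bool, (if b then (1 : ℝ) - 1 / 2 else 1 / 2) = 1 / 2 := fun b => by
      split_ifs <;> norm_num
    simp only [weight, e, Finset.prod_const, Finset.card_univ, Fintype.card_fin, one_div_pow]
  rw [biased, expect, Finset.sum_div]
  refine Finset.sum_congr rfl fun x _ => ?_
  by_cases h : x ∈ A
  · rw [Set.indicator_of_mem h, Set.indicator_of_mem h, this, Pi.one_apply]
  · rw [Set.indicator_of_notMem h, Set.indicator_of_notMem h, zero_div]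

theorem weight_flip (r : ℝ) (i : Fin n) {x : Cube n} (hx : x i = true) :
    (1 - r) * weight r (flip i x) = r * weight r x := by
  have h : ∀ j ∈ Finset.univ.erase i, (if flip i x j then 1 - r else r) =
      if x j then 1 - r else r := fun j hj => by simp [flip, Finset.ne_of_mem_erase hj]
  rw [weight, weight, ← Finset.mul_prod_erase _ _ (Finset.mem_univ i),
    ← Finset.mul_prod_erase _ _ (Finset.mem_univ i), Finset.prod_congr rfl h]
  simp [flip, hx]
  ring

/-- An event that does not depend on the `i`-th bit is independent of that bit. -/
theorem biased_inter_bit (r : ℝ) (i : Fin n) {A : Set (Cube n)}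
    (hA : ∀ x, flip i x ∈ A ↔ x ∈ A) :
    biased r (A ∩ {x | x i = true}) = (1 - r) * biased r A := by
  have h1 : biased r A = biased r (A ∩ {x | x i = true}) + biased r (A ∩ {x | x i = false}) := by
    simp only [biased, ← Finset.sum_add_distrib]
    refine Finset.sum_congr rfl fun x _ => ?_
    by_cases hx : x ∈ A <;> cases hi : x i <;> simp [hx, hi]
  have h2 : r * biased r (A ∩ {x | x i = true}) =
      (1 - r) * biased r (A ∩ {x | x i = false}) := by
    rw [biased, biased, ← sum_comp_flip i, Finset.mul_sum, Finset.mul_sum]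
    refine Finset.sum_congr rfl fun x _ => ?_
    have hbit : flip i x i = !x i := by simp [flip]
    cases hi : x i
    · have hw := weight_flip r i (x := flip i x) (by rw [hbit, hi]; rfl)
      rw [flip_involutive i x] at hw
      by_cases hx : x ∈ A
      · rw [Set.indicator_of_mem (show flip i x ∈ A ∩ {x | x i = true} from
            ⟨(hA x).mpr hx, by simp [hbit, hi]⟩),
          Set.indicator_of_mem (show x ∈ A ∩ {x | x i = false} from ⟨hx, hi⟩), hw]
      · rw [Set.indicator_of_notMem fun h => hx ((hA x).mp h.1),
          Set.indicator_of_notMem fun h => hx h.1, mul_zero, mul_zero]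
    · rw [Set.indicator_of_notMem fun h => by simpa [hbit, hi] using h.2,
        Set.indicator_of_notMem fun h => by simpa [hi] using h.2, mul_zero, mul_zero]
  rw [h1]
  linarith

/-! ### Submodular functions -/

theorem update_sup_update (x y : Cube n) (i : Fin n) (a b : Bool) :
    Function.update x i a ⊔ Function.update y i b = Function.update (x ⊔ y) i (a ⊔ b) := by
  funext j
  by_cases hj : j = i
  · subst hj
    simp
  · simp [hj]

theorem update_inf_update (x y : Cube n) (i : Fin n) (a b : Bool) :
    Function.update x i a ⊓ Function.update y i b = Function.update (x ⊓ y) i (a ⊓ b) := by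
  funext j
  by_cases hj : j = i
  · subst hj
    simp
  · simp [hj]

theorem add_flip_eq (f : Cube n → ℝ) (i : Fin n) (x : Cube n) :
    f x + f (flip i x) = f (Function.update x i true) + f (Function.update x i false) := by
  have hx : Function.update x i (x i) = x := Function.update_eq_self i x
  unfold flip
  cases h : x i
  · rw [h] at hx
    rw [hx, Bool.not_false, add_comm]
  · rw [h] at hx
    rw [hx, Bool.not_true]

/-- The marginal value of the `i`-th element. -/
def marginal (f : Cube n → ℝ) (i : Fin n) (x : Cube n) : ℝ :=
  f (Function.update x i true) - f (Function.update x i false)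

theorem abs_sub_flip (f : Cube n → ℝ) (i : Fin n) (x : Cube n) :
    |f x - f (flip i x)| = |marginal f i x| := by
  have hx : Function.update x i (x i) = x := Function.update_eq_self i x
  unfold flip marginal
  cases h : x i
  · rw [h] at hx
    rw [hx, Bool.not_false, abs_sub_comm]
  · rw [h] at hx
    rw [hx, Bool.not_true]

theorem marginal_flip (f : Cube n → ℝ) (i : Fin n) (x : Cube n) :
    marginal f i (flip i x) = marginal f i x := by
  simp [marginal, flip]

theorem IsSubmodular.antitone_marginal {f : Cube n → ℝ} (h : IsSubmodular f) (i : Fin n) :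
    Antitone (marginal f i) := by
  intro x y hxy
  have := h (Function.update x i true) (Function.update y i false)
  rw [update_sup_update, update_inf_update, sup_eq_right.mpr hxy, inf_eq_left.mpr hxy] at this
  simp only [marginal]
  have e1 : (true ⊔ false) = true := rfl
  have e2 : (true ⊓ false) = false := rfl
  rw [e1, e2] at this
  linarith

/-- By submodularity, the marginal decreases at `x` add up to at most the decrease obtained when all
the coordinates in `A` are set to `b` together. -/
theorem IsSubmodular.sum_sub_update_le {f : Cube n → ℝ} (h : IsSubmodular f) (b : Bool)
    (x : Cube n) (A : Finset (Fin n)) :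
    ∑ i ∈ A, (f x - f (Function.update x i b)) ≤ f x - f (fun j => if j ∈ A then b else x j) := by
  induction A using Finset.induction_on with
  | empty => simp
  | insert i A hi ih =>
    rw [Finset.sum_insert hi]
    set u : Cube n := fun j => if j ∈ A then b else x j with hu
    have hv : (fun j => if j ∈ insert i A then b else x j) = Function.update u i b := by
      funext j
      by_cases hj : j = i
      · simp [hj]
      · simp [hj, hu]
    rw [hv]
    have hs := h (Function.update x i b) u
    have key : f x + f (Function.update u i b) ≤ f (Function.update x i b) + f u := by
      cases b
      · have e1 : Function.update x i false ⊔ u = x := by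
          funext j
          by_cases hj : j = i
          · subst hj
            simp [hu, hi]
          · by_cases hA : j ∈ A <;> simp [hj, hu, hA]
        have e2 : Function.update x i false ⊓ u = Function.update u i false := by
          funext j
          by_cases hj : j = i
          · subst hj
            simp
          · by_cases hA : j ∈ A <;> simp [hj, hu, hA]
        rwa [e1, e2] at hs
      · have e1 : Function.update x i true ⊔ u = Function.update u i true := by
          funext j
          by_cases hj : j = i
          · subst hj
            simp
          · by_cases hA : j ∈ A <;> simp [hj, hu, hA]
        have e2 : Function.update x i true ⊓ u = x := by
          funext j
          by_cases hj : j = i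
          · subst hj
            simp [hu, hi]
          · by_cases hA : j ∈ A <;> simp [hj, hu, hA]
        rw [e1, e2] at hs
        linarith
    linarith

theorem IsSubmodular.sum_max_sub_update_le {f : Cube n → ℝ} (h : IsSubmodular f)
    (hf : ∀ x, 0 ≤ f x) (b : Bool) (x : Cube n) :
    ∑ i, max 0 (f x - f (Function.update x i b)) ≤ f x := by
  have h1 : ∑ i, max 0 (f x - f (Function.update x i b)) =
      ∑ i with 0 ≤ f x - f (Function.update x i b), (f x - f (Function.update x i b)) := by
    rw [Finset.sum_filter]
    refine Finset.sum_congr rfl fun i _ => ?_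
    split_ifs with hi
    · exact max_eq_right hi
    · exact max_eq_left (not_le.mp hi).le
  rw [h1]
  refine (h.sum_sub_update_le b x _).trans ?_
  linarith [hf fun j => if j ∈ Finset.univ.filter
    (fun i => 0 ≤ f x - f (Function.update x i b)) then b else x j]

theorem IsSubmodular.isSelfBounding {f : Cube n → ℝ} (h : IsSubmodular f)
    (hf : ∀ x, 0 ≤ f x ∧ f x ≤ 1) : IsSelfBounding 2 f := by
  refine ⟨fun x i => ?_, fun x => ?_⟩
  · have : 0 ≤ minCoord f i x := le_min (hf _).1 (hf _).1
    linarith [(hf x).2]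
  · have h1 : ∀ i, f x - minCoord f i x ≤ max 0 (f x - f (Function.update x i false)) +
        max 0 (f x - f (Function.update x i true)) := by
      intro i
      unfold minCoord
      rcases min_choice (f (Function.update x i false)) (f (Function.update x i true)) with e | e
      · rw [e]
        exact (le_max_right _ _).trans (le_add_of_nonneg_right (le_max_left _ _))
      · rw [e]
        exact (le_max_right _ _).trans (le_add_of_nonneg_left (le_max_left _ _))
    refine (Finset.sum_le_sum fun i _ => h1 i).trans ?_
    rw [Finset.sum_add_distrib]
    linarith [h.sum_max_sub_update_le (fun x => (hf x).1) false x,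
      h.sum_max_sub_update_le (fun x => (hf x).1) true x]

theorem noise_zero_mem_unit {f : Cube n → ℝ} (hf : ∀ x, 0 ≤ f x ∧ f x ≤ 1)
    (A : Finset (Fin n)) : ∀ x, 0 ≤ noise 0 A f x ∧ noise 0 A f x ≤ 1 := by
  induction A using Finset.induction_on with
  | empty => rwa [noise_empty]
  | insert i A hi ih =>
    intro x
    rw [noise_insert 0 hi]
    have h1 := ih x
    have h2 := ih (flip i x)
    constructor <;> linarith

theorem IsSubmodular.noise_zero {f : Cube n → ℝ} (h : IsSubmodular f) (A : Finset (Fin n)) :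
    IsSubmodular (noise 0 A f) := by
  induction A using Finset.induction_on with
  | empty => rwa [noise_empty]
  | insert i A hi ih =>
    have e : ∀ x, noise 0 (insert i A) f x = (noise 0 A f (Function.update x i true) +
        noise 0 A f (Function.update x i false)) / 2 := fun x => by
      rw [noise_insert 0 hi, ← add_flip_eq]
      ring
    intro x y
    have h1 := ih (Function.update x i true) (Function.update y i true)
    have h2 := ih (Function.update x i false) (Function.update y i false)
    rw [update_sup_update, update_inf_update, sup_idem, inf_idem] at h1 h2
    rw [e, e, e, e]
    linarith

theorem fourierCoeff_noise_zero (f : Cube n → ℝ) (J S : Finset (Fin n)) :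
    fourierCoeff (noise 0 Jᶜ f) S = if S ⊆ J then fourierCoeff f S else 0 := by
  have : S ∩ Jᶜ = S \ J := by rw [Finset.sdiff_eq_inter_compl]
  rw [fourierCoeff_noise, this]
  split_ifs with h
  · rw [Finset.sdiff_eq_empty_iff_subset.mpr h]
    simp
  · rw [zero_pow (by rwa [Ne, Finset.card_eq_zero, Finset.sdiff_eq_empty_iff_subset]), zero_mul]

/-! ### Coordinates with large marginals -/

/-- The elements that often have a marginal value above `α` at a sparse random set are few, since the
positive parts of `f x - f (x \ {i})` add up to at most `f x`. For every other element, the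
probability of such a marginal value at a uniform set is boosted down to `2⁻ᵏ`, because marginal
values decrease and a uniform set is a union of `k` independent sparse sets. -/
theorem IsSubmodular.exists_large_marginal {f : Cube n → ℝ} (h : IsSubmodular f)
    (hf : ∀ x, 0 ≤ f x ∧ f x ≤ 1) {α : ℝ} (hα : 0 < α) {k : ℕ} (hk : 0 < k) :
    ∃ J : Finset (Fin n), (J.card : ℝ) ≤ 4 * k / α ∧
      ∀ i ∉ J, expect ({x | α < marginal f i x}.indicator 1) ≤ (1 / 2) ^ k := by
  classical
  have hk' : (0 : ℝ) < k := Nat.cast_pos.mpr hk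
  have hk1 : (1 : ℝ) ≤ k := Nat.one_le_cast.mpr hk
  obtain ⟨r, hr0, hrk⟩ : ∃ r : ℝ, 0 ≤ r ∧ r ^ k = 1 / 2 :=
    ⟨(1 / 2) ^ ((k : ℝ)⁻¹), by positivity, Real.rpow_inv_natCast_pow (by norm_num) hk.ne'⟩
  have hr : r ≤ 1 - 1 / (2 * k) := by
    have hs : (1 : ℝ) / (2 * k) ≤ 1 / 2 := by
      rw [div_le_div_iff₀ (by positivity) (by norm_num)]
      linarith
    -- Bernoulli's inequality gives `(1 - 1 / (2 k)) ^ k ≥ 1 / 2`.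
    have hb := one_add_mul_le_pow (a := -(1 / (2 * (k : ℝ)))) (by linarith) k
    have e : 1 + (k : ℝ) * -(1 / (2 * k)) = 1 / 2 := by
      field_simp
      norm_num
    rw [e, ← hrk, ← sub_eq_add_neg] at hb
    exact le_of_pow_le_pow_left₀ hk.ne' (by linarith) hb
  have hr1 : r ≤ 1 := hr.trans (by simp)
  set A : Fin n → Set (Cube n) := fun i => {x | α < marginal f i x} with hA
  have hAlow : ∀ i, IsLowerSet (A i) := fun i x y hyx hx =>
    lt_of_lt_of_le hx (h.antitone_marginal i hyx)
  refine ⟨Finset.univ.filter fun i => 1 / 2 ≤ biased r (A i), ?_, fun i hi => ?_⟩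
  · set J := Finset.univ.filter fun i => 1 / 2 ≤ biased r (A i) with hJ
    have h1 : ∀ i, α * ((1 - r) * biased r (A i)) ≤
        ∑ x, weight r x * max 0 (f x - f (Function.update x i false)) := by
      intro i
      rw [← biased_inter_bit r i fun x => by simp [hA, marginal_flip], biased, Finset.mul_sum]
      refine Finset.sum_le_sum fun x _ => ?_
      have hw := weight_nonneg hr0 hr1 x
      by_cases hx : x ∈ A i ∩ {x | x i = true}
      · rw [Set.indicator_of_mem hx, mul_comm]
        refine mul_le_mul_of_nonneg_left (le_max_of_le_right ?_) hw
        have hxi : Function.update x i true = x := by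
          rw [← (hx.2 : x i = true), Function.update_eq_self]
        have := hx.1
        simp only [hA, Set.mem_ofPred_eq, marginal, hxi] at this
        exact this.le
      · rw [Set.indicator_of_notMem hx, mul_zero]
        positivity
    have h2 : ∑ i, α * ((1 - r) * biased r (A i)) ≤ 1 := by
      refine (Finset.sum_le_sum fun i _ => h1 i).trans ?_
      rw [Finset.sum_comm, ← sum_weight (n := n) r]
      refine Finset.sum_le_sum fun x _ => ?_
      rw [← Finset.mul_sum]
      exact mul_le_of_le_one_right (weight_nonneg hr0 hr1 x)
        ((h.sum_max_sub_update_le (fun x => (hf x).1) false x).trans (hf x).2)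
    have h3 : J.card * (α * (1 / (2 * k) * (1 / 2))) ≤ 1 := by
      refine le_trans ?_ h2
      rw [← nsmul_eq_mul, ← Finset.sum_const]
      refine le_trans (Finset.sum_le_sum fun i hi => ?_)
        (Finset.sum_le_univ_sum_of_nonneg fun i => ?_)
      · have hi' : 1 / 2 ≤ biased r (A i) := by simpa [hJ] using hi
        gcongr
        · linarith
      · have := biased_nonneg hr0 hr1 (A i)
        have := sub_nonneg.mpr hr1
        positivity
    rw [le_div_iff₀ hα]
    have : (J.card : ℝ) * (α * (1 / (2 * k) * (1 / 2))) = J.card * α / (4 * k) := by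
      field_simp
      norm_num
    rw [this, div_le_one (by positivity)] at h3
    exact h3
  · have hi' : biased r (A i) ≤ 1 / 2 := by
      by_contra hc
      exact hi (by simpa using (not_le.mp hc).le)
    rw [← biased_half, ← hrk]
    refine (biased_pow_le hr0 hr1 (hAlow i) k).trans ?_
    rw [hrk]
    exact pow_le_pow_left₀ (biased_nonneg hr0 hr1 _) hi' k

theorem IsSubmodular.comp_compl {f : Cube n → ℝ} (h : IsSubmodular f) :
    IsSubmodular fun x => f xᶜ := by
  intro x y
  have := h xᶜ yᶜ
  simp only [compl_sup, compl_inf]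
  linarith

theorem marginal_comp_compl (f : Cube n → ℝ) (i : Fin n) (x : Cube n) :
    marginal (fun x => f xᶜ) i x = -marginal f i xᶜ := by
  have e : ∀ b, (Function.update x i b)ᶜ = Function.update xᶜ i !b := by
    intro b
    funext j
    by_cases hj : j = i
    · subst hj
      simp
    · simp [hj]
  simp [marginal, e]

theorem expect_comp_compl (f : Cube n → ℝ) : expect (fun x => f xᶜ) = expect f := by
  unfold expect
  congr 1
  exact Equiv.sum_comp (compl_involutive (α := Cube n)).toPerm f

theorem IsSubmodular.exists_large_abs_marginal {f : Cube n → ℝ} (h : IsSubmodular f)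
    (hf : ∀ x, 0 ≤ f x ∧ f x ≤ 1) {α : ℝ} (hα : 0 < α) {k : ℕ} (hk : 0 < k) :
    ∃ J : Finset (Fin n), (J.card : ℝ) ≤ 8 * k / α ∧
      ∀ i ∉ J, expect ({x | α < |marginal f i x|}.indicator 1) ≤ 2 * (1 / 2) ^ k := by
  classical
  obtain ⟨J, hJ, hJ'⟩ := h.exists_large_marginal hf hα hk
  obtain ⟨K, hK, hK'⟩ := h.comp_compl.exists_large_marginal (fun x => hf xᶜ) hα hk
  refine ⟨J ∪ K, ?_, fun i hi => ?_⟩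
  · have : ((J ∪ K).card : ℝ) ≤ J.card + K.card := by exact_mod_cast Finset.card_union_le J K
    have e : 8 * (k : ℝ) / α = 4 * k / α + 4 * k / α := by ring
    linarith
  · rw [Finset.mem_union, not_or] at hi
    have h1 := hJ' i hi.1
    have h2 := hK' i hi.2
    rw [← expect_comp_compl] at h2
    have h3 : expect ({x | α < |marginal f i x|}.indicator 1) ≤
        expect (fun x => {x | α < marginal f i x}.indicator 1 x +
          {x | α < marginal (fun x => f xᶜ) i x}.indicator 1 xᶜ) := by
      refine expect_mono fun x => ?_
      simp only [Set.indicator_apply, Set.mem_ofPred_eq, marginal_comp_compl, compl_compl, lt_abs,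
        Pi.one_apply]
      split_ifs <;> first | (norm_num; done) | tauto
    rw [expect_add] at h3
    linarith

/-- A submodular function which depends only on the coordinates in `J₁` is close to a function of
`O(k / α)` of them, the error in `ℓ₂` depending on `J₁` only through `|J₁| 2⁻ᵏ`. -/
theorem IsSubmodular.exists_small_weight {f : Cube n → ℝ} (h : IsSubmodular f)
    (hf : ∀ x, 0 ≤ f x ∧ f x ≤ 1) {α : ℝ} (hα : 0 < α) {k : ℕ} (hk : 0 < k)
    {J₁ : Finset (Fin n)} (hJ₁ : ∀ S, ¬S ⊆ J₁ → fourierCoeff f S = 0) :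
    ∃ J ⊆ J₁, (J.card : ℝ) ≤ 8 * k / α ∧
      ∑ S, (if ¬S ⊆ J then fourierCoeff f S ^ 2 else 0) ≤ α + J₁.card * (1 / 2) ^ k / 2 := by
  classical
  obtain ⟨J, hJc, hJ⟩ := h.exists_large_abs_marginal hf hα hk
  refine ⟨J₁ ∩ J, Finset.inter_subset_left, ?_, ?_⟩
  · have : ((J₁ ∩ J).card : ℝ) ≤ J.card := by
      exact_mod_cast Finset.card_le_card Finset.inter_subset_right
    linarith
  have hinf : ∑ i, influence f i ≤ 2 :=
    (h.isSelfBounding hf).sum_influence_le zero_le_two hf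
  have h1 : ∀ i ∉ J, ∑ S, (if i ∈ S then fourierCoeff f S else 0) ^ 2 ≤
      α / 2 * influence f i + (1 / 2) ^ k / 2 := by
    intro i hi
    simp only [← fourierCoeff_half_diff, sum_fourierCoeff_sq]
    have h2 : expect (fun x => ((f x - f (flip i x)) / 2) ^ 2) ≤
        expect fun x => α / 2 * |(f x - f (flip i x)) / 2| +
          1 / 4 * {x | α < |marginal f i x|}.indicator 1 x := by
      refine expect_mono fun x => ?_
      simp only [Set.indicator_apply, Set.mem_ofPred_eq, ← abs_sub_flip]
      rw [← sq_abs, abs_div, abs_two]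
      have h3 : |f x - f (flip i x)| ≤ 1 := by
        rw [abs_le]
        constructor <;> linarith [(hf x).1, (hf x).2, (hf (flip i x)).1, (hf (flip i x)).2]
      have h4 := abs_nonneg (f x - f (flip i x))
      split_ifs with hx
      · simp only [Pi.one_apply]
        nlinarith
      · nlinarith
    refine h2.trans ?_
    rw [expect_add, expect_const_mul, expect_const_mul]
    have := hJ i hi
    rw [← influence]
    linarith
  have hnn : ∀ S, ∀ i, 0 ≤ (if i ∈ S then fourierCoeff f S else 0) ^ 2 := fun _ _ => sq_nonneg _
  calc ∑ S, (if ¬S ⊆ J₁ ∩ J then fourierCoeff f S ^ 2 else 0)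
      ≤ ∑ S, ∑ i ∈ J₁ \ J, (if i ∈ S then fourierCoeff f S else 0) ^ 2 := by
        refine Finset.sum_le_sum fun S _ => ?_
        split_ifs with hS
        · exact Finset.sum_nonneg fun i _ => hnn S i
        · by_cases hS1 : S ⊆ J₁
          · obtain ⟨i, hiS, hiJ⟩ := Finset.not_subset.mp fun hc => hS (Finset.subset_inter hS1 hc)
            refine le_trans ?_ (Finset.single_le_sum (fun j _ => hnn S j)
              (Finset.mem_sdiff.mpr ⟨hS1 hiS, hiJ⟩))
            rw [if_pos hiS]
          · rw [hJ₁ S hS1, zero_pow two_ne_zero]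
            exact Finset.sum_nonneg fun i _ => by split_ifs <;> simp
    _ = ∑ i ∈ J₁ \ J, ∑ S, (if i ∈ S then fourierCoeff f S else 0) ^ 2 := Finset.sum_comm
    _ ≤ ∑ i ∈ J₁ \ J, (α / 2 * influence f i + (1 / 2) ^ k / 2) :=
        Finset.sum_le_sum fun i hi => h1 i (Finset.mem_sdiff.mp hi).2
    _ = α / 2 * ∑ i ∈ J₁ \ J, influence f i + (J₁ \ J).card * ((1 / 2) ^ k / 2) := by
        rw [Finset.sum_add_distrib, ← Finset.mul_sum, Finset.sum_const, nsmul_eq_mul]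
    _ ≤ α / 2 * 2 + J₁.card * ((1 / 2) ^ k / 2) := by
        gcongr
        · exact (Finset.sum_le_univ_sum_of_nonneg fun i => influence_nonneg f i).trans hinf
        · exact Finset.sdiff_subset
    _ = α + J₁.card * (1 / 2) ^ k / 2 := by ring

/-! ### Polynomials and spectral norms -/

/-- The polynomial computing the function with Fourier coefficients `c` on `{0,1}^n`, obtained by
writing the parity of `S` as `∏ i ∈ S, (1 - 2 * X i)`. -/
noncomputable def fourierPoly (c : Finset (Fin n) → ℝ) : MvPolynomial (Fin n) ℝ :=
  ∑ S, MvPolynomial.C (c S) * ∏ i ∈ S, (1 - MvPolynomial.C 2 * MvPolynomial.X i)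

theorem polyFun_fourierPoly (c : Finset (Fin n) → ℝ) : polyFun (fourierPoly c) = synth c := by
  funext x
  simp only [polyFun, fourierPoly, map_sum, map_mul, map_prod, map_sub, map_one,
    MvPolynomial.eval_C, MvPolynomial.eval_X, synth, parity_eq_prod]
  refine Finset.sum_congr rfl fun S _ => ?_
  congr 1
  refine Finset.prod_congr rfl fun i _ => ?_
  cases x i <;> norm_num

theorem totalDegree_fourierPoly_le {c : Finset (Fin n) → ℝ} {d : ℕ}
    (h : ∀ S, c S ≠ 0 → S.card ≤ d) : (fourierPoly c).totalDegree ≤ d := by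
  refine MvPolynomial.totalDegree_finsetSum_le fun S _ => ?_
  by_cases hS : c S = 0
  · simp [hS]
  refine (MvPolynomial.totalDegree_mul _ _).trans ?_
  rw [MvPolynomial.totalDegree_C, zero_add]
  refine (MvPolynomial.totalDegree_finsetProd _ _).trans ?_
  refine (Finset.sum_le_card_nsmul S _ 1 fun i _ => ?_).trans (by simpa using h S hS)
  refine (MvPolynomial.totalDegree_sub _ _).trans (max_le (by simp) ?_)
  refine (MvPolynomial.totalDegree_mul _ _).trans ?_
  simp

theorem fourierL1Norm_synth (c : Finset (Fin n) → ℝ) : fourierL1Norm (synth c) = ∑ S, |c S| := by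
  rw [fourierL1Norm, fourierCoeff_synth]

theorem abs_fourierCoeff_le_one {f : Cube n → ℝ} (hf : ∀ x, 0 ≤ f x ∧ f x ≤ 1)
    (S : Finset (Fin n)) : |fourierCoeff f S| ≤ 1 := by
  refine (abs_expect_le _).trans ?_
  simp only [abs_mul, abs_parity, mul_one]
  exact (expect_mem_unit fun x => ⟨abs_nonneg _, by rw [abs_of_nonneg (hf x).1]; exact (hf x).2⟩).2

theorem card_small_subsets_le (J : Finset (Fin n)) (d : ℕ) :
    (Finset.univ.filter fun S : Finset (Fin n) => S.card ≤ d ∧ S ⊆ J).card ≤ (J.card + 1) ^ d := by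
  classical
  have h1 : (Finset.univ.filter fun S : Finset (Fin n) => S.card ≤ d ∧ S ⊆ J) ⊆
      (Finset.range (d + 1)).biUnion fun j => J.powersetCard j := by
    intro S hS
    simp only [Finset.mem_filter, Finset.mem_univ, true_and] at hS
    simp only [Finset.mem_biUnion, Finset.mem_range, Finset.mem_powersetCard]
    exact ⟨S.card, by omega, hS.2, rfl⟩
  refine (Finset.card_le_card h1).trans (Finset.card_biUnion_le.trans ?_)
  rw [add_pow]
  refine Finset.sum_le_sum fun j hj => ?_
  rw [Finset.card_powersetCard, one_pow, mul_one]
  refine (Nat.choose_le_pow _ _).trans (Nat.le_mul_of_pos_right _ (Nat.choose_pos ?_))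
  exact Nat.lt_succ_iff.mp (Finset.mem_range.mp hj)

/-- The noisy version of `f`, truncated to the low-degree frequencies inside `J`, is a good
approximation as soon as `f` has little low-degree weight on the frequencies not inside `J`. -/
theorem exists_poly_of_weight_le {a ε ρ : ℝ} {f : Cube n → ℝ} (hsb : IsSelfBounding a f)
    (ha : 0 ≤ a) (hf : ∀ x, 0 ≤ f x ∧ f x ≤ 1) (hε : 0 < ε) (h0 : 0 ≤ ρ) (h1 : ρ ≤ 1)
    (hρ : (1 - ρ) * a ≤ ε / 2) {d : ℕ} (hd : ρ ^ (2 * d) ≤ ε ^ 2 / 8) (J : Finset (Fin n))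
    (hW : ∑ S, (if S.card ≤ d ∧ ¬S ⊆ J then fourierCoeff f S ^ 2 else 0) ≤ ε ^ 2 / 8) :
    ∃ p : MvPolynomial (Fin n) ℝ, p.totalDegree ≤ d ∧
      l1Norm (fun x => f x - polyFun p x) ≤ ε ∧
      fourierL1Norm (polyFun p) ≤ ((J.card : ℝ) + 1) ^ d := by
  classical
  set c : Finset (Fin n) → ℝ := fun S =>
    if S.card ≤ d ∧ S ⊆ J then ρ ^ S.card * fourierCoeff f S else 0 with hc
  refine ⟨fourierPoly c, totalDegree_fourierPoly_le fun S hS => ?_, ?_, ?_⟩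
  · by_contra hcon
    exact hS (by simp [hc, hcon])
  · rw [polyFun_fourierPoly]
    have hsplit : (fun x => f x - synth c x) = fun x =>
        (f x - noise ρ Finset.univ f x) + (noise ρ Finset.univ f x - synth c x) := by
      funext x
      ring
    rw [hsplit]
    refine (l1Norm_add_le _ _).trans ?_
    have hfirst := (hsb.l1Norm_sub_noise_le ha hf h0 h1).trans hρ
    have hsecond : l1Norm (fun x => noise ρ Finset.univ f x - synth c x) ≤ ε / 2 := by
      refine abs_le_of_sq_le_sq' ?_ (by positivity) |>.2
      refine (l1Norm_sq_le _).trans ?_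
      simp only [noise, ← synth_sub, expect_synth_sq, Finset.inter_univ]
      have hS : ∀ S, (ρ ^ S.card * fourierCoeff f S - c S) ^ 2 ≤
          ρ ^ (2 * d) * fourierCoeff f S ^ 2 +
            if S.card ≤ d ∧ ¬S ⊆ J then fourierCoeff f S ^ 2 else 0 := by
        intro S
        have hnn : 0 ≤ ρ ^ (2 * d) * fourierCoeff f S ^ 2 := by positivity
        simp only [hc]
        by_cases h2 : S.card ≤ d
        · by_cases h3 : S ⊆ J
          · simpa [h2, h3] using hnn
          · rw [if_neg (by tauto), if_pos ⟨h2, h3⟩, sub_zero, mul_pow]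
            refine le_add_of_nonneg_of_le hnn (mul_le_of_le_one_left (sq_nonneg _) ?_)
            exact pow_le_one₀ (pow_nonneg h0 _) (pow_le_one₀ h0 h1)
        · rw [if_neg (by tauto), if_neg (by tauto), sub_zero, add_zero, mul_pow, ← pow_mul,
            mul_comm _ 2]
          refine mul_le_mul_of_nonneg_right (pow_le_pow_of_le_one h0 h1 ?_) (sq_nonneg _)
          omega
      refine (Finset.sum_le_sum fun S _ => hS S).trans ?_
      rw [Finset.sum_add_distrib, ← Finset.mul_sum, sum_fourierCoeff_sq]
      have hle : expect (fun x => f x ^ 2) ≤ 1 :=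
        (expect_mem_unit fun x => ⟨sq_nonneg _, pow_le_one₀ (hf x).1 (hf x).2⟩).2
      have := mul_le_of_le_one_right (pow_nonneg h0 (2 * d)) hle
      nlinarith
    linarith
  · rw [polyFun_fourierPoly, fourierL1Norm_synth]
    have hS : ∀ S, |c S| ≤ if S.card ≤ d ∧ S ⊆ J then 1 else 0 := by
      intro S
      simp only [hc]
      split_ifs
      · rw [abs_mul, abs_of_nonneg (pow_nonneg h0 _)]
        exact mul_le_one₀ (pow_le_one₀ h0 h1) (abs_nonneg _) (abs_fourierCoeff_le_one hf S)
      · simp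
    refine (Finset.sum_le_sum fun S _ => hS S).trans ?_
    rw [Finset.sum_boole]
    exact_mod_cast card_small_subsets_le J d

/-! ### Choice of the relevant coordinates -/

/-- As in Friedgut's junta theorem, the coordinates of influence above a threshold `2 ^ (-O(d))`
carry almost all of the Fourier weight of degree at most `d`. -/
theorem IsSelfBounding.exists_junta {a ε : ℝ} {f : Cube n → ℝ} (hsb : IsSelfBounding a f)
    (hf : ∀ x, 0 ≤ f x ∧ f x ≤ 1) (hε : 0 < ε) (ha : 0 < a) {d : ℕ} (hd : 1 ≤ d)
    (haε : a / ε ≤ 2 ^ d) (hε' : 1 / ε ≤ 2 ^ d) :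
    ∃ J : Finset (Fin n), (J.card : ℝ) ≤ 2 ^ (16 * d) ∧
      ∑ S, (if S.card ≤ d ∧ ¬S ⊆ J then fourierCoeff f S ^ 2 else 0) ≤ ε ^ 2 / 16 := by
  classical
  have hinf := hsb.sum_influence_le ha.le hf
  -- The value for which the bound `3 ^ d * (θ * a)` on the lost weight is `ε ^ 2 / 16`.
  set θ : ℝ := ε ^ 2 / (16 * a * 3 ^ d) with hθ
  have hθ0 : 0 < θ := by positivity
  refine ⟨Finset.univ.filter fun i => θ ^ 2 ≤ influence f i, ?_, ?_⟩
  · set J := Finset.univ.filter fun i => θ ^ 2 ≤ influence f i with hJ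
    have h1 : J.card * θ ^ 2 ≤ a := by
      refine le_trans ?_ hinf
      rw [← nsmul_eq_mul, ← Finset.sum_const]
      exact (Finset.sum_le_sum fun i hi => by simpa [hJ] using hi).trans
        (Finset.sum_le_univ_sum_of_nonneg fun i => influence_nonneg f i)
    have h2 : a / θ ^ 2 = 256 * (a / ε) ^ 3 * (1 / ε) * 9 ^ d := by
      have : (9 : ℝ) ^ d = (3 ^ d) ^ 2 := by rw [← pow_mul, mul_comm, pow_mul]; norm_num
      rw [hθ, this]
      field_simp
      norm_num
    have h256 : (256 : ℝ) ≤ (2 ^ d) ^ 8 := by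
      rw [← pow_mul]
      calc (256 : ℝ) = 2 ^ 8 := by norm_num
        _ ≤ 2 ^ (d * 8) := pow_le_pow_right₀ one_le_two (by omega)
    have h9 : (9 : ℝ) ^ d ≤ (2 ^ d) ^ 4 := by
      rw [← pow_mul, mul_comm, pow_mul]
      exact pow_le_pow_left₀ (by norm_num) (by norm_num) d
    calc (J.card : ℝ) ≤ a / θ ^ 2 := by rwa [le_div_iff₀ (by positivity)]
      _ = 256 * (a / ε) ^ 3 * (1 / ε) * 9 ^ d := h2
      _ ≤ (2 ^ d) ^ 8 * (2 ^ d) ^ 3 * 2 ^ d * (2 ^ d) ^ 4 := by gcongr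
      _ = 2 ^ (16 * d) := by ring
  · refine (weight_outside_le hf hinf hθ0.le _ (fun i hi => ?_) d).trans (le_of_eq ?_)
    · by_contra hc
      exact hi (by simpa using (not_le.mp hc).le)
    · rw [hθ]
      field_simp

/-- For submodular `f` the exponentially large set `J₁` is cut down to polynomial size in `d` and
`1 / ε`. The argument is applied to the average of `f` over the coordinates outside `J₁`, which is
again submodular and has the same Fourier coefficients as `f` inside `J₁`. -/
theorem IsSubmodular.exists_junta {ε : ℝ} {f : Cube n → ℝ} (h : IsSubmodular f)
    (hf : ∀ x, 0 ≤ f x ∧ f x ≤ 1) (hε : 0 < ε) {d : ℕ} (hd : 1 ≤ d) (hε' : 1 / ε ≤ 2 ^ d)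
    {J₁ : Finset (Fin n)} (hJ₁ : (J₁.card : ℝ) ≤ 2 ^ (16 * d))
    (hW : ∑ S, (if S.card ≤ d ∧ ¬S ⊆ J₁ then fourierCoeff f S ^ 2 else 0) ≤ ε ^ 2 / 16) :
    ∃ J : Finset (Fin n), (J.card : ℝ) ≤ 2 ^ (16 * d) ∧ (J.card : ℝ) ≤ 5632 * d / ε ^ 2 ∧
      ∑ S, (if S.card ≤ d ∧ ¬S ⊆ J then fourierCoeff f S ^ 2 else 0) ≤ ε ^ 2 / 8 := by
  classical
  -- With this choice `2⁻ᵏ` beats the size of `J₁`.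
  set k := 22 * d with hk
  obtain ⟨J, hJJ, hJc, hJ⟩ := (h.noise_zero J₁ᶜ).exists_small_weight
    (noise_zero_mem_unit hf J₁ᶜ) (α := ε ^ 2 / 32) (by positivity) (k := k) (by omega)
    (fun S hS => by rw [fourierCoeff_noise_zero, if_neg hS])
  refine ⟨J, ?_, ?_, ?_⟩
  · exact le_trans (by exact_mod_cast Finset.card_le_card hJJ) hJ₁
  · refine hJc.trans (le_of_eq ?_)
    rw [hk]
    push_cast
    field_simp
    norm_num
  · have hsmall : (J₁.card : ℝ) * (1 / 2) ^ k ≤ ε ^ 2 / 16 := by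
      have h1 : 1 ≤ (2 : ℝ) ^ d * ε := by
        rwa [div_le_iff₀ hε] at hε'
      have h16 : (16 : ℝ) ≤ 2 ^ (4 * d) := by
        calc (16 : ℝ) = 2 ^ 4 := by norm_num
          _ ≤ 2 ^ (4 * d) := pow_le_pow_right₀ one_le_two (by omega)
      have h2 : (2 : ℝ) ^ (16 * d) * 16 ≤ ε ^ 2 * 2 ^ k := by
        calc (2 : ℝ) ^ (16 * d) * 16 ≤ 2 ^ (16 * d) * 2 ^ (4 * d) := by gcongr
          _ = 1 ^ 2 * 2 ^ (20 * d) := by rw [← pow_add]; ring_nf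
          _ ≤ (2 ^ d * ε) ^ 2 * 2 ^ (20 * d) := by gcongr
          _ = ε ^ 2 * 2 ^ k := by rw [hk]; ring
      rw [one_div_pow, mul_one_div, div_le_div_iff₀ (by positivity) (by norm_num)]
      exact (mul_le_mul_of_nonneg_right hJ₁ (by norm_num)).trans h2
    have hsum : ∑ S, (if S.card ≤ d ∧ ¬S ⊆ J then fourierCoeff f S ^ 2 else 0) ≤
        ∑ S, ((if S.card ≤ d ∧ ¬S ⊆ J₁ then fourierCoeff f S ^ 2 else 0) +
          if ¬S ⊆ J then fourierCoeff (noise 0 J₁ᶜ f) S ^ 2 else 0) := by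
      refine Finset.sum_le_sum fun S _ => ?_
      rw [fourierCoeff_noise_zero]
      have := sq_nonneg (fourierCoeff f S)
      split_ifs <;> first | (simp; done) | (simp; positivity) | tauto
    refine hsum.trans ?_
    rw [Finset.sum_add_distrib]
    linarith

/-! ### Choice of the degree -/

theorem half_le_log_inv {ε : ℝ} (hε : 0 < ε) (hε2 : ε < 1 / 2) : 1 / 2 ≤ Real.log (1 / ε) := by
  have h2 : (2 : ℝ) ≤ 1 / ε := by
    rw [le_div_iff₀ hε]
    linarith
  have := Real.log_le_log two_pos h2
  linarith [Real.log_two_gt_d9]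

/-- The degree `d ≈ 5 (a / ε) log (1 / ε)`: noise of rate `ε / (2 a)` shrinks the squares of the
coefficients of degree above `d` by a factor `ε ^ 5`, which is at most `ε ^ 2 / 8` for
`ε < 1 / 2`. -/
theorem exists_degree {a ε : ℝ} (hε : 0 < ε) (hε2 : ε < 1 / 2) (haε : ε < a) :
    ∃ d : ℕ, 1 ≤ d ∧ (d : ℝ) ≤ 7 * (a / ε) * Real.log (1 / ε) ∧ a / ε ≤ 2 ^ d ∧
      1 / ε ≤ 2 ^ d ∧ (1 - ε / (2 * a)) ^ (2 * d) ≤ ε ^ 2 / 8 := by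
  set L := Real.log (1 / ε) with hL
  have hL2 : 1 / 2 ≤ L := half_le_log_inv hε hε2
  have ha : 0 < a := hε.trans haε
  have hr : 1 ≤ a / ε := by
    rw [one_le_div hε]
    exact haε.le
  have hrL : a / ε * (1 / 2) ≤ a / ε * L := by gcongr
  have hrL' : 1 * L ≤ a / ε * L := by gcongr
  have hdl : 5 * (a / ε) * L ≤ ⌈5 * (a / ε) * L⌉₊ := Nat.le_ceil _
  have hdu : (⌈5 * (a / ε) * L⌉₊ : ℝ) < 5 * (a / ε) * L + 1 := Nat.ceil_lt_add_one (by positivity)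
  set d := ⌈5 * (a / ε) * L⌉₊ with hd
  have hexpL : Real.exp L = 1 / ε := Real.exp_log (by positivity)
  refine ⟨d, ?_, by linarith, ?_, ?_, ?_⟩
  · have : (1 : ℝ) ≤ d := by linarith
    exact_mod_cast this
  · have h1 : (d : ℝ) < 2 ^ d := by exact_mod_cast Nat.lt_two_pow_self
    linarith
  · have h2 : (2 : ℝ) ^ d = Real.exp (d * Real.log 2) := by
      rw [mul_comm, Real.exp_mul, Real.exp_log two_pos, Real.rpow_natCast]
    rw [← hexpL, h2]
    refine Real.exp_le_exp.mpr ?_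
    have h3 : (d : ℝ) * (1 / 2) ≤ d * Real.log 2 := by
      gcongr
      linarith [Real.log_two_gt_d9]
    linarith
  · have hle : ε / (2 * a) ≤ 1 := by
      rw [div_le_one (by positivity)]
      linarith
    have h1 : (1 - ε / (2 * a)) ^ (2 * d) ≤ Real.exp (-(5 * L)) := by
      calc (1 - ε / (2 * a)) ^ (2 * d) ≤ Real.exp (-(ε / (2 * a))) ^ (2 * d) :=
            pow_le_pow_left₀ (by linarith) (Real.one_sub_le_exp_neg _) _
        _ = Real.exp (-(d * (ε / a))) := by
            rw [← Real.exp_nat_mul]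
            congr 1
            push_cast
            field_simp
        _ ≤ Real.exp (-(5 * L)) := by
            refine Real.exp_le_exp.mpr (neg_le_neg ?_)
            calc 5 * L = 5 * (a / ε) * L * (ε / a) := by field_simp
              _ ≤ d * (ε / a) := by gcongr
    have h2 : Real.exp (-(5 * L)) = ε ^ 5 := by
      rw [Real.exp_neg, (by norm_num : (5 : ℝ) = (5 : ℕ)), Real.exp_nat_mul, hexpL]
      simp
    rw [h2] at h1
    have h3 : ε ^ 3 ≤ (1 / 2) ^ 3 := pow_le_pow_left₀ hε.le hε2.le 3
    nlinarith [sq_nonneg ε]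

theorem general_spectral_bound {j : ℝ} {d : ℕ} (hj0 : 0 ≤ j) (hd : 1 ≤ d)
    (hj : j ≤ 2 ^ (16 * d)) : (j + 1) ^ d ≤ (2 : ℝ) ^ (17 * (d : ℝ) ^ 2) := by
  have h1 : j + 1 ≤ 2 ^ (17 * d) := by
    have h2 : (1 : ℝ) ≤ 2 ^ (16 * d) := one_le_pow₀ one_le_two
    calc j + 1 ≤ 2 ^ (16 * d) * 2 := by linarith
      _ = 2 ^ (16 * d + 1) := by rw [pow_succ]
      _ ≤ 2 ^ (17 * d) := pow_le_pow_right₀ one_le_two (by omega)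
  calc (j + 1) ^ d ≤ (2 ^ (17 * d)) ^ d := pow_le_pow_left₀ (by positivity) h1 d
    _ = (2 : ℝ) ^ (17 * (d : ℝ) ^ 2) := by
      rw [← pow_mul, ← Real.rpow_natCast]
      congr 1
      push_cast
      ring

theorem submodular_spectral_bound {j ε : ℝ} {d : ℕ} (hε : 0 < ε) (hε2 : ε < 1 / 2)
    (hj0 : 0 ≤ j) (hd : (d : ℝ) ≤ 14 * (1 / ε) * Real.log (1 / ε))
    (hj : j ≤ 5632 * d / ε ^ 2) :
    (j + 1) ^ d ≤ (2 : ℝ) ^ (1000 * (1 / ε) * Real.log (1 / ε) ^ 2) := by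
  set L := Real.log (1 / ε) with hL
  have hL2 : 1 / 2 ≤ L := half_le_log_inv hε hε2
  have hexpL : Real.exp L = 1 / ε := Real.exp_log (by positivity)
  set y := 1 / ε with hy
  have hy0 : 0 < y := by positivity
  have hy1 : 1 ≤ y := by
    rw [hy, one_le_div hε]
    linarith
  have hLy : L ≤ y := by
    have := Real.add_one_le_exp L
    linarith
  have h1 : j + 1 ≤ 2 ^ 17 * y ^ 4 := by
    have e : 5632 * (d : ℝ) / ε ^ 2 = 5632 * d * y ^ 2 := by
      rw [hy]
      field_simp
    have h2 : (d : ℝ) ≤ 14 * y * y := hd.trans (by gcongr)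
    have h3 : 5632 * (d : ℝ) * y ^ 2 ≤ 5632 * (14 * y * y) * y ^ 2 := by gcongr
    have h4 : 1 ≤ y ^ 4 := one_le_pow₀ hy1
    rw [e] at hj
    nlinarith
  have h2 : (2 : ℝ) ^ 17 * y ^ 4 ≤ 2 ^ (42 * L) := by
    have hy4 : y ≤ 2 ^ (2 * L) := by
      rw [Real.rpow_def_of_pos two_pos, ← hexpL]
      refine Real.exp_le_exp.mpr ?_
      nlinarith [Real.log_two_gt_d9]
    have h17 : (2 : ℝ) ^ 17 ≤ 2 ^ (34 * L) := by
      rw [← Real.rpow_natCast]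
      refine Real.rpow_le_rpow_of_exponent_le one_le_two ?_
      push_cast
      linarith
    calc (2 : ℝ) ^ 17 * y ^ 4 ≤ 2 ^ (34 * L) * (2 ^ (2 * L)) ^ 4 := by gcongr
      _ = 2 ^ (42 * L) := by
        rw [← Real.rpow_natCast, ← Real.rpow_mul zero_le_two, ← Real.rpow_add two_pos]
        congr 1
        push_cast
        ring
  calc (j + 1) ^ d ≤ (2 ^ (42 * L)) ^ d := pow_le_pow_left₀ (by positivity) (h1.trans h2) d
    _ = (2 : ℝ) ^ (42 * L * d) := by
      rw [← Real.rpow_natCast, ← Real.rpow_mul zero_le_two]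
    _ ≤ (2 : ℝ) ^ (1000 * y * L ^ 2) := by
      refine Real.rpow_le_rpow_of_exponent_le one_le_two ?_
      calc 42 * L * d ≤ 42 * L * (14 * y * L) := by gcongr
        _ = 588 * (y * L ^ 2) := by ring
        _ ≤ 1000 * (y * L ^ 2) := by gcongr; norm_num
        _ = 1000 * y * L ^ 2 := by ring

/-! ### The approximation theorem -/

theorem exists_const_poly {f : Cube n → ℝ} {v ε : ℝ} (hv : |v| ≤ 1)
    (h : l1Norm (fun x => f x - v) ≤ ε) :
    ∃ p : MvPolynomial (Fin n) ℝ, p.totalDegree ≤ 0 ∧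
      l1Norm (fun x => f x - polyFun p x) ≤ ε ∧ fourierL1Norm (polyFun p) ≤ 1 := by
  have hs : synth (fun S : Finset (Fin n) => if S = ∅ then v else 0) = fun _ => v := by
    funext x
    simp [synth, parity]
  refine ⟨fourierPoly fun S => if S = ∅ then v else 0, totalDegree_fourierPoly_le fun S hS => ?_,
    ?_, ?_⟩
  · have : S = ∅ := by
      by_contra hc
      exact hS (if_neg hc)
    simp [this]
  · rwa [polyFun_fourierPoly, hs]
  · rw [polyFun_fourierPoly, fourierL1Norm_synth]
    simpa [apply_ite abs] using hv

/-- The approximation theorem with the original `a`; the spectral bound for submodular functions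
needs `a ≤ 2` here. When `ε` is at least `1 / 2` or `a`, the admissible degree may be less than `1`,
and a constant is used. -/
theorem IsSelfBounding.exists_poly {a ε : ℝ} {f : Cube n → ℝ} (hsb : IsSelfBounding a f)
    (ha : 0 ≤ a) (hf : ∀ x, 0 ≤ f x ∧ f x ≤ 1) (hε : 0 < ε) :
    ∃ (d : ℕ) (p : MvPolynomial (Fin n) ℝ),
      (d : ℝ) ≤ 7 * (a / ε) * max (Real.log (1 / ε)) 0 ∧ p.totalDegree ≤ d ∧
      l1Norm (fun x => f x - polyFun p x) ≤ ε ∧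
      fourierL1Norm (polyFun p) ≤ (2 : ℝ) ^ (17 * (d : ℝ) ^ 2) ∧
      (IsSubmodular f → a ≤ 2 → fourierL1Norm (polyFun p) ≤
        (2 : ℝ) ^ (1000 * (1 / ε) * max (Real.log (1 / ε)) 0 ^ 2)) := by
  by_cases hconst : 1 / 2 ≤ ε ∨ a ≤ ε
  · obtain ⟨v, hv, hvε⟩ : ∃ v : ℝ, |v| ≤ 1 ∧ l1Norm (fun x => f x - v) ≤ ε := by
      rcases hconst with h | h
      · refine ⟨1 / 2, by norm_num [abs_le], le_trans ?_ h⟩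
        have h1 : ∀ x, |f x - 1 / 2| ≤ 1 / 2 := fun x => by
          rw [abs_le]
          constructor <;> linarith [(hf x).1, (hf x).2]
        exact (expect_mono h1).trans (expect_const _).le
      · refine ⟨fourierCoeff f ∅, abs_fourierCoeff_le_one hf ∅, le_trans ?_ h⟩
        have h1 := hsb.l1Norm_sub_noise_le ha hf le_rfl zero_le_one
        -- Full noise on all coordinates leaves only the expectation of `f`.
        have h2 : noise 0 Finset.univ f = fun _ => fourierCoeff f ∅ := by
          funext x
          rw [noise, synth, Finset.sum_eq_single ∅]
          · simp [parity]
          · intro S _ hS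
            rw [Finset.inter_univ, zero_pow (Finset.card_ne_zero.mpr
              (Finset.nonempty_iff_ne_empty.mpr hS)), zero_mul, zero_mul]
          · simp
        rwa [h2, sub_zero, one_mul] at h1
    obtain ⟨p, hp, hpε, hp1⟩ := exists_const_poly hv hvε
    refine ⟨0, p, ?_, hp, hpε, hp1.trans ?_, fun _ _ => hp1.trans ?_⟩
    · have : 0 ≤ max (Real.log (1 / ε)) 0 := le_max_right _ _
      push_cast
      positivity
    · exact Real.one_le_rpow one_le_two (by positivity)
    · have : 0 ≤ max (Real.log (1 / ε)) 0 := le_max_right _ _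
      exact Real.one_le_rpow one_le_two (by positivity)
  · push Not at hconst
    obtain ⟨hε2, haε⟩ := hconst
    have ha0 : 0 < a := hε.trans haε
    have hL := half_le_log_inv hε hε2
    obtain ⟨d, hd1, hd, had, hεd, hρ⟩ := exists_degree hε hε2 haε
    rw [max_eq_left (by linarith)]
    have hρ0 : ε / (2 * a) ≤ 1 := by
      rw [div_le_one (by positivity)]
      linarith
    have hρa : (1 - (1 - ε / (2 * a))) * a ≤ ε / 2 := le_of_eq (by field_simp; ring)
    have hρ1 : 1 - ε / (2 * a) ≤ 1 := sub_le_self _ (by positivity)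
    obtain ⟨J₁, hJ₁, hW₁⟩ := hsb.exists_junta hf hε ha0 hd1 had hεd
    by_cases hsub : IsSubmodular f ∧ a ≤ 2
    · obtain ⟨J, hJ, hJ', hW⟩ := hsub.1.exists_junta hf hε hd1 hεd hJ₁ hW₁
      obtain ⟨p, hp, hpε, hpJ⟩ :=
        exists_poly_of_weight_le hsb ha hf hε (by linarith) hρ1 hρa hρ J hW
      refine ⟨d, p, hd, hp, hpε, hpJ.trans (general_spectral_bound (by positivity) hd1 hJ),
        fun _ _ => hpJ.trans (submodular_spectral_bound hε hε2 (by positivity) ?_ hJ')⟩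
      refine hd.trans ?_
      gcongr ?_ * _
      rw [← mul_one_div a]
      have : a * (1 / ε) ≤ 2 * (1 / ε) := mul_le_mul_of_nonneg_right hsub.2 (by positivity)
      linarith
    · obtain ⟨p, hp, hpε, hpJ⟩ := exists_poly_of_weight_le hsb ha hf hε (by linarith) hρ1 hρa hρ J₁
        (hW₁.trans (by linarith [sq_nonneg ε]))
      exact ⟨d, p, hd, hp, hpε, hpJ.trans (general_spectral_bound (by positivity) hd1 hJ₁),
        fun h1 h2 => absurd ⟨h1, h2⟩ hsub⟩

end BoolCube

theorem mainTheorem10 :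
    ∃ (C : ℝ) (k : ℕ), 0 < C ∧
      ∀ (n : ℕ) (a : ℝ) (f : BoolCube.Cube n → ℝ), 0 ≤ a →
        (∀ x, 0 ≤ f x ∧ f x ≤ 1) → BoolCube.IsSelfBounding a f →
        ∀ ε : ℝ, 0 < ε →
          ∃ (d : ℕ) (p : MvPolynomial (Fin n) ℝ),
            (d : ℝ) ≤ C * (a / ε) * max (Real.log (1 / ε)) 0 ∧
            p.totalDegree ≤ d ∧
            BoolCube.l1Norm (fun x => f x - BoolCube.polyFun p x) ≤ ε ∧
            BoolCube.fourierL1Norm (BoolCube.polyFun p) ≤ (2 : ℝ) ^ (C * (d : ℝ) ^ 2) ∧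
            (BoolCube.IsSubmodular f →
              BoolCube.fourierL1Norm (BoolCube.polyFun p) ≤
                (2 : ℝ) ^ (C * (1 / ε) * max (Real.log (1 / ε)) 0 ^ k)) := by
  refine ⟨1000, 2, by norm_num, fun n a f ha hf hsb ε hε => ?_⟩
  have hL : 0 ≤ max (Real.log (1 / ε)) 0 := le_max_right _ _
  -- A submodular function is also `2`-self-bounding, so the smaller of `a` and `2` can be used.
  obtain ⟨b, hb0, hba, hbsb, hb2⟩ : ∃ b : ℝ, 0 ≤ b ∧ b ≤ a ∧ BoolCube.IsSelfBounding b f ∧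
      (BoolCube.IsSubmodular f → b ≤ 2) := by
    by_cases h : BoolCube.IsSubmodular f ∧ 2 ≤ a
    · exact ⟨2, zero_le_two, h.2, h.1.isSelfBounding hf, fun _ => le_rfl⟩
    · exact ⟨a, ha, le_rfl, hsb, fun hs => (not_le.mp fun h2 => h ⟨hs, h2⟩).le⟩
  obtain ⟨d, p, hd, hp, hpε, hp1, hp2⟩ := hbsb.exists_poly hb0 hf hε
  refine ⟨d, p, hd.trans ?_, hp, hpε, hp1.trans ?_, fun hs => hp2 hs (hb2 hs)⟩
  · gcongr
    norm_num
  · refine Real.rpow_le_rpow_of_exponent_le one_le_two ?_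
    gcongr
    norm_num
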